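/- Let $\gamma>0$, let $L=\tfrac12\Delta$ be the symmetric operator on $L^2(\mathbf R^3)$ (Lebesgue measure, real or complex scalars) with domain $C_c^\infty(\mathbf R^3\setminus\{0\})$, and let $$\psi_\gamma(x)=\frac{\sqrt\gamma}{\sqrt{2\pi}}\,\frac{e^{-\gamma|x|}}{|x|},\qquad x\in\mathbf R^3\setminus\{0\}.$$ There is exactly one self-adjoint extension $\mathcal L_\gamma$ of $L$ on $L^2(\mathbf R^3)$ for which $\psi_\gamma\in\mathcal D(\mathcal L_\gamma)$ and $\mathcal L_\gamma\psi_\gamma=\tfrac{\gamma^2}{2}\psi_\gamma$; it is the restriction of the adjoint $L^*$ to $\mathcal D(\overline L)+\operatorname{span}\{\psi_\gamma\}$, where $\overline L$ is the closure of $L$. The operator $-\mathcal L_\gamma$ is lower bounded with parameter $\gamma^2/2$, i.e. $$(-\mathcal L_\gamma u,u)_{L^2(\mathbf R^3)}+\frac{\gamma^2}{2}(u,u)_{L^2(\mathbf R^3)}\ge 0\qquad\text{for all }u\in\mathcal D(\mathcal L_\gamma).$$ Consequently, $\mathcal L_\gamma$ is the infinitesimal generator of a unique strongly continuous semigroup $(Q_t)_{t\ge0}$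 of bounded operators on $L^2(\mathbf R^3)$, and $$\|Q_t\|_{L^2(\mathbf R^3)}\le e^{\gamma^2t/2}\qquad\text{for all }t\ge0.$$ -/

import Mathlib

open MeasureTheory Filter Topology
open scoped NNReal InnerProductSpace ComplexOrder ContDiff LinearPMap

noncomputable section

namespace ZeroRange

/-- Three-dimensional Euclidean space. -/
abbrev R3 : Type := EuclideanSpace ℝ (Fin 3)

/-- The Hilbert space `L²(ℝ³)` of (classes of) square-integrable `𝕜`-valued functions with respect to
Lebesgue measure, where `𝕜` is `ℝ` or `ℂ`. -/
abbrev L2 (𝕜 : Type*) [RCLike 𝕜] : Type _ := Lp 𝕜 2 (volume : Measure R3)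

/-- The class `C_c^∞(ℝ³ ∖ {0})`: smooth functions with compact support contained in `ℝ³ ∖ {0}`
(extended by `0` to the origin). -/
structure IsPuncturedTest {𝕜 : Type*} [RCLike 𝕜] (f : R3 → 𝕜) : Prop where
  smooth : ContDiff ℝ ∞ f
  compact : HasCompactSupport f
  support : (0 : R3) ∉ tsupport f

/-- The function `½ Δ f`. -/
def halfLaplacian {𝕜 : Type*} [RCLike 𝕜] (f : R3 → 𝕜) : R3 → 𝕜 :=
  fun x => (1 / 2 : ℝ) • Laplacian.laplacian f x

theorem IsPuncturedTest.zero {𝕜 : Type*} [RCLike 𝕜] :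
    IsPuncturedTest (0 : R3 → 𝕜) where
  smooth := contDiff_const
  compact := HasCompactSupport.zero
  support := by simp [tsupport]

theorem IsPuncturedTest.add {𝕜 : Type*} [RCLike 𝕜] {f g : R3 → 𝕜}
    (hf : IsPuncturedTest f) (hg : IsPuncturedTest g) : IsPuncturedTest (f + g) where
  smooth := hf.smooth.add hg.smooth
  compact := hf.compact.add hg.compact
  support := fun h => (tsupport_add f g h).elim hf.support hg.support

theorem IsPuncturedTest.smul {𝕜 : Type*} [RCLike 𝕜] {f : R3 → 𝕜} (c : 𝕜)
    (hf : IsPuncturedTest f) : IsPuncturedTest (c • f) where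
  smooth := contDiff_const.smul hf.smooth
  compact := hf.compact.smul_left (f := fun _ => c)
  support := fun h => hf.support (tsupport_smul_subset_right (fun _ => c) f h)

theorem halfLaplacian_zero {𝕜 : Type*} [RCLike 𝕜] :
    halfLaplacian (0 : R3 → 𝕜) = 0 := by
  funext x
  have h : Laplacian.laplacian (0 : R3 → 𝕜) = 0 :=
    InnerProductSpace.laplacian_const (c := (0 : 𝕜))
  simp [halfLaplacian, h]

theorem halfLaplacian_add {𝕜 : Type*} [RCLike 𝕜] {f g : R3 → 𝕜}
    (hf : IsPuncturedTest f) (hg : IsPuncturedTest g) :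
    halfLaplacian (f + g) = halfLaplacian f + halfLaplacian g := by
  funext x
  have hf' : ContDiffAt ℝ 2 f x := (hf.smooth.of_le (WithTop.coe_le_coe.2 le_top)).contDiffAt
  have hg' : ContDiffAt ℝ 2 g x := (hg.smooth.of_le (WithTop.coe_le_coe.2 le_top)).contDiffAt
  simp only [halfLaplacian, Pi.add_apply, hf'.laplacian_add hg', smul_add]

theorem halfLaplacian_smul {𝕜 : Type*} [RCLike 𝕜] {f : R3 → 𝕜} (c : 𝕜)
    (hf : IsPuncturedTest f) : halfLaplacian (c • f) = c • halfLaplacian f := by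
  funext x
  have hf' : ContDiffAt ℝ 2 f x := (hf.smooth.of_le (WithTop.coe_le_coe.2 le_top)).contDiffAt
  simp only [halfLaplacian, Pi.smul_apply, InnerProductSpace.laplacian_smul c hf']
  exact smul_comm _ _ _

/-- The graph of `½ Δ` on `C_c^∞(ℝ³ ∖ {0})`, as a subspace of `L²(ℝ³) × L²(ℝ³)`. -/
def minimalGraph (𝕜 : Type*) [RCLike 𝕜] : Submodule 𝕜 (L2 𝕜 × L2 𝕜) where
  carrier := {p | ∃ f : R3 → 𝕜, IsPuncturedTest f ∧
    p.1 =ᵐ[volume] f ∧ p.2 =ᵐ[volume] halfLaplacian f}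
  zero_mem' := ⟨0, IsPuncturedTest.zero, Lp.coeFn_zero _ _ _, by
    rw [halfLaplacian_zero]; exact Lp.coeFn_zero _ _ _⟩
  add_mem' := by
    rintro p q ⟨f, hf, hf1, hf2⟩ ⟨g, hg, hg1, hg2⟩
    refine ⟨f + g, hf.add hg, (Lp.coeFn_add _ _).trans (hf1.add hg1), ?_⟩
    rw [halfLaplacian_add hf hg]
    exact (Lp.coeFn_add _ _).trans (hf2.add hg2)
  smul_mem' := by
    rintro c p ⟨f, hf, hf1, hf2⟩
    refine ⟨c • f, hf.smul c, (Lp.coeFn_smul _ _).trans (hf1.const_smul c), ?_⟩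
    rw [halfLaplacian_smul c hf]
    exact (Lp.coeFn_smul _ _).trans (hf2.const_smul c)

/-- The symmetric operator `½ Δ` on `L²(ℝ³)` with domain `C_c^∞(ℝ³ ∖ {0})`. -/
def minimalOperator (𝕜 : Type*) [RCLike 𝕜] : L2 𝕜 →ₗ.[𝕜] L2 𝕜 :=
  (minimalGraph 𝕜).toLinearPMap

/-- The graph above is single-valued, so that it really is the graph of `minimalOperator`. -/
theorem graph_minimalOperator (𝕜 : Type*) [RCLike 𝕜] :
    (minimalOperator 𝕜).graph = minimalGraph 𝕜 := by
  refine Submodule.toLinearPMap_graph_eq _ ?_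
  rintro ⟨u, v⟩ ⟨f, hf, hf1, hf2⟩ (hu : u = 0)
  subst hu
  have h0 : f = 0 := by
    refine Continuous.ae_eq_iff_eq volume hf.smooth.continuous continuous_zero |>.1 ?_
    exact hf1.symm.trans (Lp.coeFn_zero _ _ _)
  subst h0
  rw [halfLaplacian_zero] at hf2
  exact Lp.ext (hf2.trans (Lp.coeFn_zero _ _ _).symm)

/-- The function `ψ_γ(x) = √γ / √(2π) · e^{-γ|x|} / |x|`. -/
def psi (γ : ℝ) (x : R3) : ℝ :=
  Real.sqrt γ / Real.sqrt (2 * Real.pi) * (Real.exp (-γ * ‖x‖) / ‖x‖)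

theorem memLp_psi (𝕜 : Type*) [RCLike 𝕜] {γ : ℝ} (hγ : 0 < γ) :
    MemLp (fun x => ((psi γ x : ℝ) : 𝕜)) 2 (volume : Measure R3) := by
  have hm : Measurable (psi γ) := by unfold psi; fun_prop
  have hr : MemLp (psi γ) 2 (volume : Measure R3) := by
    rw [memLp_two_iff_integrable_sq hm.aestronglyMeasurable]
    have h := integrable_fun_norm_addHaar (volume : Measure R3)
      (f := fun r : ℝ => (Real.sqrt γ / Real.sqrt (2 * Real.pi) * (Real.exp (-γ * r) / r)) ^ 2)
    refine h.2 ?_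
    have hi : IntegrableOn (fun r : ℝ => (Real.sqrt γ / Real.sqrt (2 * Real.pi)) ^ 2 *
        Real.exp (-(2 * γ) * r)) (Set.Ioi 0) :=
      (exp_neg_integrableOn_Ioi 0 (by positivity : 0 < 2 * γ)).const_mul _
    refine hi.congr_fun ?_ measurableSet_Ioi
    intro r (hr : 0 < r)
    have he : Real.exp (-(2 * γ) * r) = Real.exp (-γ * r) ^ 2 := by
      rw [← Real.exp_nat_mul]; congr 1; push_cast; ring
    simp only [finrank_euclideanSpace, Fintype.card_fin, smul_eq_mul, he]
    norm_num
    field_simp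
  exact hr.ofReal

/-- `ψ_γ` as an element of `L²(ℝ³)`. -/
def psiL2 (𝕜 : Type*) [RCLike 𝕜] {γ : ℝ} (hγ : 0 < γ) : L2 𝕜 := (memLp_psi 𝕜 hγ).toLp _

/-- The operator `𝓛_γ` for `γ > 0`: the restriction of the adjoint `L†` of the minimal operator `L`
to the domain of the closure of `L`, enlarged by the line spanned by `ψ_γ`. -/
def zeroRangeOperator (𝕜 : Type*) [RCLike 𝕜] {γ : ℝ} (hγ : 0 < γ) : L2 𝕜 →ₗ.[𝕜] L2 𝕜 :=
  (minimalOperator 𝕜)†.domRestrict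
    ((minimalOperator 𝕜).closure.domain ⊔ Submodule.span 𝕜 {psiL2 𝕜 hγ})

/-- `A` is a self-adjoint extension of `½ Δ` on `C_c^∞(ℝ³ ∖ {0})` for which `ψ_γ` is an eigenfunction
with eigenvalue `γ² / 2`. -/
structure IsZeroRangeExtension {𝕜 : Type*} [RCLike 𝕜] {γ : ℝ} (hγ : 0 < γ)
    (A : L2 𝕜 →ₗ.[𝕜] L2 𝕜) : Prop where
  selfAdjoint : IsSelfAdjoint A
  extends_minimal : minimalOperator 𝕜 ≤ A
  eigen : (psiL2 𝕜 hγ, ((γ ^ 2 / 2 : ℝ) : 𝕜) • psiL2 𝕜 hγ) ∈ A.graph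

/-- `Q` is the strongly continuous semigroup of bounded operators with infinitesimal generator `A`:
`u ∈ D(A)` and `A u = v` if and only if `(Q_t u - u) / t → v` as `t ↓ 0`. -/
structure IsSemigroupGeneratedBy {𝕜 H : Type*} [RCLike 𝕜] [NormedAddCommGroup H]
    [NormedSpace 𝕜 H] (A : H →ₗ.[𝕜] H) (Q : ℝ≥0 → H →L[𝕜] H) : Prop where
  map_zero : Q 0 = ContinuousLinearMap.id 𝕜 H
  map_add : ∀ s t : ℝ≥0, Q (s + t) = (Q s).comp (Q t)
  continuous_orbit : ∀ u : H, Continuous fun t : ℝ≥0 => Q t u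
  generator : ∀ u v : H, (u, v) ∈ A.graph ↔
    Tendsto (fun t : ℝ≥0 => (((t : ℝ) : 𝕜)⁻¹) • (Q t u - u)) (𝓝[>] 0) (𝓝 v)

end ZeroRange

end

/-! Put `μ = γ² / 2`. The operator theory uses only that `L` is densely defined, symmetric and
nonpositive, and that the kernel of `L† - μ` is the line spanned by `ψ` (`HasSimpleDeficiency`).
Nonpositivity bounds `μ - closure L` below by `μ`, so its range is closed and contains the whole
orthogonal complement of `ψ`. If `(x, y)` lies in the adjoint of the extension, then `μ x - y` is
orthogonal to `ψ`, hence equals `(μ - closure L) q` for some `q`, and `x - q` lies in the kernel of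
`L† - μ`: the extension is self-adjoint. Any other candidate contains it, and self-adjoint operators
have no proper self-adjoint extensions. For `u = q + c ψ` one has `(μ - A) u = (μ - closure L) q`,
orthogonal to `ψ`, so `⟪(μ - A) u, u⟫ = ⟪(μ - closure L) q, q⟫`, whose real part is nonnegative;
this is the lower bound.

Generation is the Hille–Yosida theorem for `A - μ`, by Yosida approximation; uniqueness and the norm
bound follow from Grönwall's inequality for the squared norm of an orbit.

The analytic core is the simplicity of the kernel (`exists_ae_eq_mul_psi`). If `w ∈ L²` is
orthogonal to `(μ - ½ Δ) C_c^∞(ℝ³ ∖ {0})`, cutting off near `0` and infinity shows that it is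
orthogonal to `(μ - ½ Δ) f` for every Schwartz `f` with `f 0 = 0`. So `f ↦ ∫ w (μ - ½ Δ) f` is a
multiple of evaluation at the origin. Since `μ - ½ Δ` is onto on Schwartz functions, that multiple
determines `w`; for `ψ_γ` it is nonzero, so `w` is proportional to `ψ_γ`. -/

namespace ZeroRange

/-! ### Abstract extension theory with a one-dimensional kernel of `L† - μ`. -/

section Abstract

variable {𝕜 H : Type*} [RCLike 𝕜] [NormedAddCommGroup H] [InnerProductSpace 𝕜 H]

/-- If the form of `y` at `x` is at most `c ‖x‖²`, then `μ x - y` is bounded below. -/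
theorem mul_norm_le_norm_smul_sub {c μ : ℝ} {x y : H}
    (h : RCLike.re ⟪y, x⟫_𝕜 ≤ c * ‖x‖ ^ 2) :
    (μ - c) * ‖x‖ ≤ ‖(μ : 𝕜) • x - y‖ := by
  have h1 : RCLike.re ⟪(μ : 𝕜) • x - y, x⟫_𝕜 = μ * ‖x‖ ^ 2 - RCLike.re ⟪y, x⟫_𝕜 := by
    rw [inner_sub_left, inner_smul_left, map_sub, RCLike.conj_ofReal, RCLike.re_ofReal_mul,
      inner_self_eq_norm_sq]
  have h2 : RCLike.re ⟪(μ : 𝕜) • x - y, x⟫_𝕜 ≤ ‖(μ : 𝕜) • x - y‖ * ‖x‖ :=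
    re_inner_le_norm _ _
  rcases (norm_nonneg x).eq_or_lt with h0 | h0
  · rw [← h0, mul_zero]; exact norm_nonneg _
  · refine le_of_mul_le_mul_right ?_ h0
    nlinarith

variable [CompleteSpace H]

/-- If `μ - G` is bounded below for a closed relation `G`, then its range contains every vector
orthogonal to the kernel of the adjoint. -/
theorem exists_mem_smul_sub_eq {G : Submodule 𝕜 (H × H)} (hG : IsClosed (G : Set (H × H)))
    {μ m : ℝ} (hm : 0 < m) (hb : ∀ p ∈ G, m * ‖p.1‖ ≤ ‖(μ : 𝕜) • p.1 - p.2‖) {z : H}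
    (hz : ∀ v : H, (∀ p ∈ G, ⟪v, p.2⟫_𝕜 = (μ : 𝕜) * ⟪v, p.1⟫_𝕜) → ⟪v, z⟫_𝕜 = 0) :
    ∃ p ∈ G, (μ : 𝕜) • p.1 - p.2 = z := by
  set T : H × H →L[𝕜] H :=
    (μ : 𝕜) • ContinuousLinearMap.fst 𝕜 H H - ContinuousLinearMap.snd 𝕜 H H with hT
  set S : G →L[𝕜] H := T.comp G.subtypeL with hS
  have hSa : ∀ p : G, S p = (μ : 𝕜) • (p : H × H).1 - (p : H × H).2 := fun p => rfl
  -- The norm of a pair is the larger of its component norms: the first is at most `m⁻¹ ‖S p‖`, the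
  -- second at most `(1 + |μ| m⁻¹) ‖S p‖`, and the constant dominates both. With `G` complete, this
  -- makes the range of `S` closed.
  have hanti : AntilipschitzWith (Real.toNNReal (1 + (1 + |μ|) * m⁻¹)) S := by
    refine ContinuousLinearMap.antilipschitz_of_bound _ fun p => ?_
    rw [Real.coe_toNNReal _ (by positivity)]
    have h1 : ‖(p : H × H).1‖ ≤ m⁻¹ * ‖S p‖ := by
      rw [inv_mul_eq_div, le_div_iff₀ hm, mul_comm, hSa]
      exact hb p p.2
    have h2 : ‖(p : H × H).2‖ ≤ ‖S p‖ + |μ| * ‖(p : H × H).1‖ := by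
      have : (p : H × H).2 = (μ : 𝕜) • (p : H × H).1 - S p := by rw [hSa]; abel
      calc ‖(p : H × H).2‖ = ‖(μ : 𝕜) • (p : H × H).1 - S p‖ := by rw [← this]
        _ ≤ ‖(μ : 𝕜) • (p : H × H).1‖ + ‖S p‖ := norm_sub_le _ _
        _ = _ := by rw [norm_smul, RCLike.norm_ofReal, add_comm]
    have h3 : |μ| * ‖(p : H × H).1‖ ≤ |μ| * (m⁻¹ * ‖S p‖) := by gcongr
    have h4 : 0 ≤ m⁻¹ * ‖S p‖ := by positivity
    have h5 : 0 ≤ |μ| * (m⁻¹ * ‖S p‖) := by positivity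
    have h6 := norm_nonneg (S p)
    rw [Submodule.coe_norm, Prod.norm_def]
    refine max_le ?_ ?_ <;> nlinarith
  have : CompleteSpace G := hG.completeSpace_coe
  have hcl : IsClosed (Set.range S) := hanti.isClosed_range S.uniformContinuous
  set R : Submodule 𝕜 H := LinearMap.range (S : G →ₗ[𝕜] H) with hR
  have hRc : IsClosed (R : Set H) := by
    have : (R : Set H) = Set.range S := by ext; simp [hR]
    rwa [this]
  have hzR : z ∈ R := by
    rw [← hRc.submodule_topologicalClosure_eq, ← Submodule.orthogonal_orthogonal_eq_closure,
      Submodule.mem_orthogonal]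
    intro v hv
    refine hz v fun p hp => ?_
    have := (Submodule.mem_orthogonal' _ _).1 hv (S ⟨p, hp⟩) ⟨⟨p, hp⟩, rfl⟩
    rw [hSa, inner_sub_right, inner_smul_right, sub_eq_zero] at this
    exact this.symm
  obtain ⟨p, hp⟩ := hzR
  exact ⟨p, p.2, hp⟩

/-- A densely defined nonpositive symmetric operator `L` for which the kernel of `L† - μ` is the
line spanned by `ψ`. -/
structure HasSimpleDeficiency (L : H →ₗ.[𝕜] H) (μ : ℝ) (ψ : H) : Prop where
  dense : Dense (L.domain : Set H)
  symm : ∀ p ∈ L.graph, ∀ q ∈ L.graph, ⟪p.2, q.1⟫_𝕜 = ⟪p.1, q.2⟫_𝕜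
  nonpos : ∀ p ∈ L.graph, RCLike.re ⟪p.2, p.1⟫_𝕜 ≤ 0
  pos : 0 < μ
  eigen : ∀ p ∈ L.graph, ⟪ψ, p.2⟫_𝕜 = (μ : 𝕜) * ⟪ψ, p.1⟫_𝕜
  simple : ∀ v : H, (∀ p ∈ L.graph, ⟪v, p.2⟫_𝕜 = (μ : 𝕜) * ⟪v, p.1⟫_𝕜) →
    v ∈ Submodule.span 𝕜 {ψ}

theorem mem_adjoint_graph_iff {L : H →ₗ.[𝕜] H} (hd : Dense (L.domain : Set H)) {p : H × H} :
    p ∈ L†.graph ↔ ∀ q ∈ L.graph, ⟪p.1, q.2⟫_𝕜 = ⟪p.2, q.1⟫_𝕜 := by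
  rw [LinearPMap.adjoint_graph_eq_graph_adjoint hd, Submodule.mem_adjoint_iff]
  constructor
  · intro h q hq
    have := sub_eq_zero.1 (h q.1 q.2 hq)
    rw [← inner_conj_symm, this, inner_conj_symm]
  · intro h a b hab
    have := h (a, b) hab
    rw [sub_eq_zero, ← inner_conj_symm, this, inner_conj_symm]

namespace HasSimpleDeficiency

variable {L : H →ₗ.[𝕜] H} {μ : ℝ} {ψ : H}

theorem graph_le_adjoint (h : HasSimpleDeficiency L μ ψ) : L.graph ≤ L†.graph :=
  fun p hp => (mem_adjoint_graph_iff h.dense).2 fun q hq => (h.symm p hp q hq).symm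

theorem isClosable (h : HasSimpleDeficiency L μ ψ) : L.IsClosable :=
  (LinearPMap.adjoint_isClosed h.dense).isClosable.leIsClosable
    (LinearPMap.le_of_le_graph h.graph_le_adjoint)

theorem closure_graph_le_adjoint (h : HasSimpleDeficiency L μ ψ) :
    L.closure.graph ≤ L†.graph := by
  rw [← h.isClosable.graph_closure_eq_closure_graph]
  exact Submodule.topologicalClosure_minimal _ h.graph_le_adjoint
    (LinearPMap.adjoint_isClosed h.dense)

theorem isClosed_closure_graph (h : HasSimpleDeficiency L μ ψ) :
    IsClosed (L.closure.graph : Set (H × H)) := h.isClosable.closure_isClosed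

/-- Closability makes the graph of the closure the topological closure of the graph, so closed
conditions pass to it. -/
theorem closure_induction (h : HasSimpleDeficiency L μ ψ) {P : H × H → Prop}
    (hc : IsClosed {p | P p}) (hP : ∀ p ∈ L.graph, P p) : ∀ p ∈ L.closure.graph, P p := by
  intro p hp
  rw [← h.isClosable.graph_closure_eq_closure_graph] at hp
  exact closure_minimal (s := (L.graph : Set (H × H))) (t := {p | P p}) hP hc hp

theorem closure_nonpos (h : HasSimpleDeficiency L μ ψ) :
    ∀ p ∈ L.closure.graph, RCLike.re ⟪p.2, p.1⟫_𝕜 ≤ 0 :=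
  h.closure_induction (isClosed_le (by fun_prop) continuous_const) h.nonpos

theorem closure_eigen (h : HasSimpleDeficiency L μ ψ) :
    ∀ p ∈ L.closure.graph, ⟪ψ, p.2⟫_𝕜 = (μ : 𝕜) * ⟪ψ, p.1⟫_𝕜 :=
  h.closure_induction (isClosed_eq (by fun_prop) (by fun_prop)) h.eigen

theorem eigen_mem_adjoint (h : HasSimpleDeficiency L μ ψ) :
    (ψ, (μ : 𝕜) • ψ) ∈ L†.graph := by
  refine (mem_adjoint_graph_iff h.dense).2 fun q hq => ?_
  rw [h.eigen q hq, inner_smul_left, RCLike.conj_ofReal]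

theorem closure_symm (h : HasSimpleDeficiency L μ ψ) :
    ∀ p ∈ L.closure.graph, ∀ q ∈ L.closure.graph, ⟪p.2, q.1⟫_𝕜 = ⟪p.1, q.2⟫_𝕜 := by
  intro p hp
  -- Density is needed in `q` only: `p` already belongs to the graph of `L†`.
  refine h.closure_induction (isClosed_eq (by fun_prop) (by fun_prop)) fun q hq => ?_
  exact ((mem_adjoint_graph_iff h.dense).1 (h.closure_graph_le_adjoint hp) q hq).symm

/-- The graph of the restriction of `L†` to `D(closure L) + span ψ`. -/
theorem mem_graph_iff (h : HasSimpleDeficiency L μ ψ) {p : H × H} :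
    p ∈ (L†.domRestrict (L.closure.domain ⊔ Submodule.span 𝕜 {ψ})).graph ↔
      ∃ q ∈ L.closure.graph, ∃ c : 𝕜, p = q + c • (ψ, (μ : 𝕜) • ψ) := by
  constructor
  · intro hp
    have hp' : p ∈ L†.graph := LinearPMap.le_graph_of_le LinearPMap.domRestrict_le hp
    have hd := LinearPMap.mem_domain_of_mem_graph (x := p.1) (y := p.2) hp
    obtain ⟨x, hx, y, hy, hxy⟩ := Submodule.mem_sup.1 hd.1
    obtain ⟨c, rfl⟩ := Submodule.mem_span_singleton.1 hy
    obtain ⟨z, hz⟩ := LinearPMap.mem_domain_iff.1 hx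
    refine ⟨(x, z), hz, c, Prod.ext hxy.symm (LinearPMap.mem_graph_snd_inj' L† hp' ?_ hxy.symm)⟩
    exact add_mem (h.closure_graph_le_adjoint hz) (Submodule.smul_mem _ _ h.eigen_mem_adjoint)
  · rintro ⟨q, hq, c, rfl⟩
    have hmem : q + c • (ψ, (μ : 𝕜) • ψ) ∈ L†.graph :=
      add_mem (h.closure_graph_le_adjoint hq) (Submodule.smul_mem _ _ h.eigen_mem_adjoint)
    obtain ⟨y, hy1, hy2⟩ := (LinearPMap.mem_graph_iff _).1 hmem
    refine (LinearPMap.mem_graph_iff _).2 ⟨⟨y, ?_, y.2⟩, hy1, ?_⟩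
    · rw [hy1]
      exact Submodule.add_mem_sup (LinearPMap.mem_domain_of_mem_graph (y := q.2) hq)
        (Submodule.smul_mem _ _ (Submodule.mem_span_singleton_self ψ))
    · rw [← hy2]
      exact LinearPMap.domRestrict_apply rfl

/-- Every vector orthogonal to `ψ` is in the range of `μ - closure L`. -/
theorem exists_closure_smul_sub_eq (h : HasSimpleDeficiency L μ ψ) {z : H}
    (hz : ⟪ψ, z⟫_𝕜 = 0) : ∃ p ∈ L.closure.graph, (μ : 𝕜) • p.1 - p.2 = z := by
  refine exists_mem_smul_sub_eq h.isClosed_closure_graph (μ := μ) (m := μ - 0)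
    (by simpa using h.pos)
    (fun p hp => mul_norm_le_norm_smul_sub (by simpa using h.closure_nonpos p hp)) fun v hv => ?_
  have hle : L.graph ≤ L.closure.graph := LinearPMap.le_graph_of_le L.le_closure
  obtain ⟨c, rfl⟩ := Submodule.mem_span_singleton.1 (h.simple v fun p hp => hv p (hle hp))
  rw [inner_smul_left, hz, mul_zero]

/-- The closure part is symmetric; the cross terms and the `ψ` term match because `ψ` is an
eigenvector of `L†` with a real eigenvalue. -/
theorem extension_symm (h : HasSimpleDeficiency L μ ψ) {p q : H × H}
    (hp : p ∈ (L†.domRestrict (L.closure.domain ⊔ Submodule.span 𝕜 {ψ})).graph)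
    (hq : q ∈ (L†.domRestrict (L.closure.domain ⊔ Submodule.span 𝕜 {ψ})).graph) :
    ⟪p.2, q.1⟫_𝕜 = ⟪p.1, q.2⟫_𝕜 := by
  obtain ⟨p, hp', c, rfl⟩ := h.mem_graph_iff.1 hp
  obtain ⟨q, hq', d, rfl⟩ := h.mem_graph_iff.1 hq
  have e1 := h.closure_symm p hp' q hq'
  have e2 := h.closure_eigen q hq'
  have e3 : ⟪p.2, ψ⟫_𝕜 = (μ : 𝕜) * ⟪p.1, ψ⟫_𝕜 := by
    rw [← inner_conj_symm, h.closure_eigen p hp', map_mul, inner_conj_symm, RCLike.conj_ofReal]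
  simp only [Prod.fst_add, Prod.snd_add, Prod.smul_fst, Prod.smul_snd, inner_add_left,
    inner_add_right, inner_smul_left, inner_smul_right, e1, e2, e3, RCLike.conj_ofReal]
  ring

theorem graph_le_extension (h : HasSimpleDeficiency L μ ψ) :
    L.graph ≤ (L†.domRestrict (L.closure.domain ⊔ Submodule.span 𝕜 {ψ})).graph :=
  fun p hp => h.mem_graph_iff.2 ⟨p, LinearPMap.le_graph_of_le L.le_closure hp, 0, by simp⟩

theorem eigen_mem_extension (h : HasSimpleDeficiency L μ ψ) :
    (ψ, (μ : 𝕜) • ψ) ∈ (L†.domRestrict (L.closure.domain ⊔ Submodule.span 𝕜 {ψ})).graph :=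
  h.mem_graph_iff.2 ⟨0, zero_mem _, 1, by simp⟩

/-- The restriction of `L†` to `D(closure L) + span ψ` is self-adjoint. -/
theorem extension_isSelfAdjoint (h : HasSimpleDeficiency L μ ψ) :
    IsSelfAdjoint (L†.domRestrict (L.closure.domain ⊔ Submodule.span 𝕜 {ψ})) := by
  have hLA := h.graph_le_extension
  have hψA := h.eigen_mem_extension
  set A := L†.domRestrict (L.closure.domain ⊔ Submodule.span 𝕜 {ψ}) with hA
  have hd : Dense (A.domain : Set H) :=
    h.dense.mono (LinearPMap.le_of_le_graph hLA).1
  rw [LinearPMap.isSelfAdjoint_def]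
  refine LinearPMap.eq_of_eq_graph (le_antisymm ?_ ?_)
  · intro p hp
    rw [mem_adjoint_graph_iff hd] at hp
    -- Test the adjoint relation against the eigenvector; the defect can then be removed by an
    -- element of the closure.
    have hz : ⟪ψ, (μ : 𝕜) • p.1 - p.2⟫_𝕜 = 0 := by
      have := hp _ hψA
      rw [inner_smul_right] at this
      rw [inner_sub_right, inner_smul_right, sub_eq_zero, ← inner_conj_symm ψ p.2, ← this, map_mul,
        inner_conj_symm, RCLike.conj_ofReal]
    obtain ⟨q, hq, hqz⟩ := h.exists_closure_smul_sub_eq hz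
    have h3 : p.2 = (μ : 𝕜) • p.1 - ((μ : 𝕜) • q.1 - q.2) := by rw [hqz]; abel
    -- Both `p` and `q` satisfy the adjoint relation on `L` and have the same image under `μ - L†`,
    -- so their difference is in the kernel.
    have hv : p.1 - q.1 ∈ Submodule.span 𝕜 {ψ} := by
      refine h.simple _ fun r hr => ?_
      have h1 := hp r (hLA hr)
      have h2 := (mem_adjoint_graph_iff h.dense).1 (h.closure_graph_le_adjoint hq) r hr
      rw [inner_sub_left, h1, h2, h3]
      simp only [inner_sub_left, inner_smul_left, RCLike.conj_ofReal]
      ring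
    obtain ⟨c, hc⟩ := Submodule.mem_span_singleton.1 hv
    refine h.mem_graph_iff.2 ⟨q, hq, c, Prod.ext ?_ ?_⟩
    · simp [hc]
    · simp only [Prod.snd_add, Prod.smul_snd]
      rw [smul_comm, hc, h3, smul_sub]
      abel
  · intro p hp
    exact (mem_adjoint_graph_iff hd).2 fun q hq => (h.extension_symm hp hq).symm

/-- A self-adjoint extension of `L` with eigenvector `ψ` is the restriction of `L†` to
`D(closure L) + span ψ`. -/
theorem selfAdjoint_eq_extension (h : HasSimpleDeficiency L μ ψ) {B : H →ₗ.[𝕜] H}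
    (hB : IsSelfAdjoint B) (hLB : L ≤ B) (hψB : (ψ, (μ : 𝕜) • ψ) ∈ B.graph) :
    B = L†.domRestrict (L.closure.domain ⊔ Submodule.span 𝕜 {ψ}) := by
  have hAB : (L†.domRestrict (L.closure.domain ⊔ Submodule.span 𝕜 {ψ})).graph ≤ B.graph := by
    intro p hp
    obtain ⟨q, hq, c, rfl⟩ := h.mem_graph_iff.1 hp
    refine add_mem ?_ (Submodule.smul_mem _ _ hψB)
    exact h.closure_induction (P := fun p => p ∈ B.graph) hB.isClosed
      (fun p hp => LinearPMap.le_graph_of_le hLB hp) q hq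
  refine LinearPMap.eq_of_eq_graph (le_antisymm ?_ hAB)
  intro p hp
  -- Adjoints reverse inclusion: the extension lies in `B`, so `B = B†` lies in its adjoint, which
  -- is the extension itself.
  rw [← LinearPMap.isSelfAdjoint_def.1 h.extension_isSelfAdjoint,
    mem_adjoint_graph_iff h.extension_isSelfAdjoint.dense_domain]
  rw [← LinearPMap.isSelfAdjoint_def.1 hB, mem_adjoint_graph_iff hB.dense_domain] at hp
  exact fun q hq => hp q (hAB hq)

/-- The `ψ` component of `u` is annihilated by `μ` minus the extension, and the remaining image is
orthogonal to `ψ`. The form of `μ` minus the extension at `u` is therefore that of `μ - closure L`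
at `q.1`, which has nonnegative real part. -/
theorem extension_re_inner_le (h : HasSimpleDeficiency L μ ψ) {p : H × H}
    (hp : p ∈ (L†.domRestrict (L.closure.domain ⊔ Submodule.span 𝕜 {ψ})).graph) :
    RCLike.re ⟪p.2, p.1⟫_𝕜 ≤ μ * ‖p.1‖ ^ 2 := by
  obtain ⟨q, hq, c, rfl⟩ := h.mem_graph_iff.1 hp
  set u : H := q.1 + c • ψ with hu
  have e : (μ : 𝕜) • u - (q.2 + c • (μ : 𝕜) • ψ) = (μ : 𝕜) • q.1 - q.2 := by
    rw [hu, smul_add, smul_comm c]; abel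
  have e3 : ⟪q.2, ψ⟫_𝕜 = (μ : 𝕜) * ⟪q.1, ψ⟫_𝕜 := by
    rw [← inner_conj_symm, h.closure_eigen q hq, map_mul, inner_conj_symm, RCLike.conj_ofReal]
  have e4 : RCLike.re ⟪(μ : 𝕜) • u - (q.2 + c • (μ : 𝕜) • ψ), u⟫_𝕜
      = μ * ‖q.1‖ ^ 2 - RCLike.re ⟪q.2, q.1⟫_𝕜 := by
    have : ⟪(μ : 𝕜) • u - (q.2 + c • (μ : 𝕜) • ψ), u⟫_𝕜
        = (μ : 𝕜) * ⟪q.1, q.1⟫_𝕜 - ⟪q.2, q.1⟫_𝕜 := by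
      rw [e, hu]
      simp only [inner_sub_left, inner_add_right, inner_smul_left, inner_smul_right, e3,
        RCLike.conj_ofReal]
      ring
    rw [this, map_sub, RCLike.re_ofReal_mul, inner_self_eq_norm_sq]
  rw [inner_sub_left, inner_smul_left, RCLike.conj_ofReal, map_sub, RCLike.re_ofReal_mul,
    inner_self_eq_norm_sq] at e4
  have h1 := h.closure_nonpos q hq
  have h2 : 0 ≤ μ * ‖q.1‖ ^ 2 := mul_nonneg h.pos.le (by positivity)
  change RCLike.re ⟪q.2 + c • (μ : 𝕜) • ψ, u⟫_𝕜 ≤ μ * ‖u‖ ^ 2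
  linarith

end HasSimpleDeficiency

end Abstract

end ZeroRange

namespace ZeroRange

/-! ### Grönwall's inequality, and its consequences for semigroups with a given generator. -/

section Semigroup

variable {𝕜 H : Type*} [RCLike 𝕜] [NormedAddCommGroup H] [InnerProductSpace 𝕜 H]

/-- Grönwall's inequality for a curve whose right derivative has a bounded above energy form. -/
theorem norm_le_exp_mul_of_right_slope {g g' : ℝ → H} {c : ℝ} (hg : Continuous g)
    (hg' : ∀ t, 0 ≤ t →
      Tendsto (fun h : ℝ => ((h : 𝕜)⁻¹) • (g (t + h) - g t)) (𝓝[>] 0) (𝓝 (g' t)))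
    (hc : ∀ t, 0 ≤ t → RCLike.re ⟪g' t, g t⟫_𝕜 ≤ c * ‖g t‖ ^ 2) {t : ℝ} (ht : 0 ≤ t) :
    ‖g t‖ ≤ Real.exp (c * t) * ‖g 0‖ := by
  let _ : InnerProductSpace ℝ H := InnerProductSpace.rclikeToReal 𝕜 H
  have hd : ∀ s, 0 ≤ s → HasDerivWithinAt g (g' s) (Set.Ioi s) s := by
    intro s hs
    rw [hasDerivWithinAt_iff_tendsto_slope' (by simp)]
    have h1 : Tendsto (fun y : ℝ => y - s) (𝓝[>] s) (𝓝[>] 0) := by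
      refine tendsto_nhdsWithin_iff.2 ⟨?_, ?_⟩
      · have : Tendsto (fun y : ℝ => y - s) (𝓝 s) (𝓝 (s - s)) := tendsto_id.sub_const s
        rw [sub_self] at this
        exact this.mono_left nhdsWithin_le_nhds
      · filter_upwards [self_mem_nhdsWithin] with y hy
        exact sub_pos.2 (Set.mem_Ioi.1 hy)
    refine ((hg' s hs).comp h1).congr fun y => ?_
    simp only [Function.comp_apply, slope_def_module, add_sub_cancel]
    rw [RCLike.real_smul_eq_coe_smul (K := 𝕜), RCLike.ofReal_inv]
  -- The right derivative of `‖g‖²` is `2 Re ⟪g, g'⟫ ≤ 2 c ‖g‖²`, hence the rate `2 * c`; taking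
  -- square roots restores `c`.
  have key := le_gronwallBound_of_liminf_deriv_right_le (f := fun s => ‖g s‖ ^ 2)
    (f' := fun s => 2 * RCLike.re ⟪g s, g' s⟫_𝕜) (δ := ‖g 0‖ ^ 2) (K := 2 * c) (ε := 0)
    (a := 0) (b := t) (by fun_prop) ?_ le_rfl ?_ t (Set.right_mem_Icc.2 ht)
  · rw [gronwallBound_ε0, sub_zero] at key
    refine le_of_sq_le_sq ?_ (by positivity)
    rw [mul_pow, ← Real.exp_nat_mul]
    calc ‖g t‖ ^ 2 ≤ ‖g 0‖ ^ 2 * Real.exp (2 * c * t) := key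
      _ = _ := by rw [mul_comm]; congr 2; push_cast; ring
  · intro s hs r hr
    have h2 := (hd s hs.1).norm_sq
    rw [hasDerivWithinAt_iff_tendsto_slope' (by simp)] at h2
    refine (((tendsto_order.1 h2).2 r hr).mono fun y hy => ?_).frequently
    rw [slope_def_module, smul_eq_mul] at hy
    exact hy
  · intro s hs
    have := hc s hs.1
    rw [inner_re_symm] at this
    change 2 * RCLike.re ⟪g s, g' s⟫_𝕜 ≤ 2 * c * ‖g s‖ ^ 2 + 0
    linarith

theorem tendsto_toNNReal_nhdsGT_zero : Tendsto Real.toNNReal (𝓝[>] (0 : ℝ)) (𝓝[>] 0) := by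
  refine tendsto_nhdsWithin_iff.2 ⟨?_, ?_⟩
  · have : Tendsto Real.toNNReal (𝓝 (0 : ℝ)) (𝓝 (Real.toNNReal 0)) :=
      continuous_real_toNNReal.tendsto 0
    rw [Real.toNNReal_zero] at this
    exact this.mono_left nhdsWithin_le_nhds
  · filter_upwards [self_mem_nhdsWithin] with y hy
    exact Real.toNNReal_pos.2 hy

theorem tendsto_coe_nhdsGT_zero :
    Tendsto (fun t : ℝ≥0 => (t : ℝ)) (𝓝[>] 0) (𝓝[>] (0 : ℝ)) := by
  refine tendsto_nhdsWithin_iff.2 ⟨?_, ?_⟩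
  · have : Tendsto (fun t : ℝ≥0 => (t : ℝ)) (𝓝 0) (𝓝 ((0 : ℝ≥0) : ℝ)) :=
      NNReal.continuous_coe.tendsto 0
    exact this.mono_left nhdsWithin_le_nhds
  · filter_upwards [self_mem_nhdsWithin] with y hy
    exact NNReal.coe_pos.2 hy

namespace IsSemigroupGeneratedBy

variable {A : H →ₗ.[𝕜] H} {Q Q' : ℝ≥0 → H →L[𝕜] H}

/-- `Q t` is continuous and commutes with every `Q s`, so it carries the difference quotients at `u`
to those at `Q t u`. -/
theorem apply_mem_graph (hQ : IsSemigroupGeneratedBy A Q) {u v : H} (h : (u, v) ∈ A.graph)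
    (t : ℝ≥0) : (Q t u, Q t v) ∈ A.graph := by
  rw [hQ.generator] at h ⊢
  refine (((Q t).continuous.tendsto v).comp h).congr fun s => ?_
  have : Q s (Q t u) = Q t (Q s u) := by
    rw [← ContinuousLinearMap.comp_apply, ← hQ.map_add, add_comm, hQ.map_add]; rfl
  simp [this]

theorem right_slope (hQ : IsSemigroupGeneratedBy A Q) {u v : H} (h : (u, v) ∈ A.graph)
    {t : ℝ} (ht : 0 ≤ t) :
    Tendsto (fun h : ℝ => ((h : 𝕜)⁻¹) • (Q (t + h).toNNReal u - Q t.toNNReal u)) (𝓝[>] 0)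
      (𝓝 (Q t.toNNReal v)) := by
  have h1 := (hQ.generator _ _).1 (hQ.apply_mem_graph h t.toNNReal)
  refine (h1.comp tendsto_toNNReal_nhdsGT_zero).congr' ?_
  filter_upwards [self_mem_nhdsWithin] with s (hs : 0 < s)
  rw [Function.comp_apply, Real.coe_toNNReal s hs.le, Real.toNNReal_add ht hs.le, add_comm,
    hQ.map_add]
  rfl

/-- For `u` in the domain, the difference of the two orbits solves the same evolution equation with
initial value `0`; Grönwall annihilates it, and density does the rest. -/
theorem unique (hQ : IsSemigroupGeneratedBy A Q) (hQ' : IsSemigroupGeneratedBy A Q')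
    (hA : Dense (A.domain : Set H)) {c : ℝ}
    (hc : ∀ p ∈ A.graph, RCLike.re ⟪p.2, p.1⟫_𝕜 ≤ c * ‖p.1‖ ^ 2) : Q = Q' := by
  funext t
  refine ContinuousLinearMap.ext fun x => ?_
  refine congrFun (Continuous.ext_on hA (Q t).continuous (Q' t).continuous fun u hu => ?_) x
  obtain ⟨v, h⟩ := LinearPMap.mem_domain_iff.1 hu
  have key := norm_le_exp_mul_of_right_slope (𝕜 := 𝕜) (c := c) (t := t)
    (g := fun s : ℝ => Q s.toNNReal u - Q' s.toNNReal u)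
    (g' := fun s : ℝ => Q s.toNNReal v - Q' s.toNNReal v)
    (((hQ.continuous_orbit u).comp continuous_real_toNNReal).sub
      ((hQ'.continuous_orbit u).comp continuous_real_toNNReal))
    (fun s hs => ((hQ.right_slope h hs).sub (hQ'.right_slope h hs)).congr fun r => by
      rw [← smul_sub]; congr 1; abel)
    (fun s hs => hc _ (sub_mem (hQ.apply_mem_graph h s.toNNReal)
      (hQ'.apply_mem_graph h s.toNNReal))) t.2
  simp only [Real.toNNReal_zero, hQ.map_zero, hQ'.map_zero, sub_self, norm_zero, mul_zero,
    Real.toNNReal_coe] at key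
  exact sub_eq_zero.1 (norm_le_zero_iff.1 key)

theorem norm_le (hQ : IsSemigroupGeneratedBy A Q)
    (hA : Dense (A.domain : Set H)) {c : ℝ}
    (hc : ∀ p ∈ A.graph, RCLike.re ⟪p.2, p.1⟫_𝕜 ≤ c * ‖p.1‖ ^ 2) (t : ℝ≥0) :
    ‖Q t‖ ≤ Real.exp (c * t) := by
  refine ContinuousLinearMap.opNorm_le_bound _ (Real.exp_pos _).le fun x => ?_
  refine hA.induction (P := fun x => ‖Q t x‖ ≤ Real.exp (c * t) * ‖x‖) (fun u hu => ?_)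
    (isClosed_le (by fun_prop) (by fun_prop)) x
  obtain ⟨v, h⟩ := LinearPMap.mem_domain_iff.1 hu
  have key := norm_le_exp_mul_of_right_slope (𝕜 := 𝕜) (c := c) (t := t)
    (g := fun s : ℝ => Q s.toNNReal u) (g' := fun s : ℝ => Q s.toNNReal v)
    ((hQ.continuous_orbit u).comp continuous_real_toNNReal)
    (fun s hs => hQ.right_slope h hs) (fun s hs => hc _ (hQ.apply_mem_graph h s.toNNReal)) t.2
  simpa only [Real.toNNReal_zero, hQ.map_zero, Real.toNNReal_coe, ContinuousLinearMap.id_apply] using key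

end IsSemigroupGeneratedBy

/-! ### Exponentials of bounded dissipative operators. -/

open NormedSpace in
theorem commute_exp_left {X Y : H →L[𝕜] H} (h : Commute X Y) : Commute (exp X) Y := by
  let _ : NormedAlgebra ℚ (H →L[𝕜] H) := NormedAlgebra.restrictScalars ℚ 𝕜 _
  exact h.exp_left

/-- A bounded operator whose exponentials `exp (t X)`, `t ≥ 0`, are contractions. -/
def IsContractive (X : H →L[𝕜] H) : Prop :=
  ∀ t : ℝ, 0 ≤ t → ∀ u : H, ‖NormedSpace.exp ((t : 𝕜) • X) u‖ ≤ ‖u‖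

theorem isContractive_zero : IsContractive (0 : H →L[𝕜] H) := fun t _ u => by simp

variable [CompleteSpace H]

open NormedSpace in
theorem exp_add_of_commute_clm {X Y : H →L[𝕜] H} (h : Commute X Y) :
    exp (X + Y) = exp X * exp Y := by
  let _ : NormedAlgebra ℚ (H →L[𝕜] H) := NormedAlgebra.restrictScalars ℚ 𝕜 _
  exact exp_add_of_commute h

open NormedSpace in
theorem hasDerivAt_exp_add_smul_apply {X Y : H →L[𝕜] H} (h : Commute Y X) (u : H) (t : 𝕜) :
    HasDerivAt (fun s : 𝕜 => exp (Y + s • X) u) (exp (Y + t • X) (X u)) t := by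
  have e : ∀ s : 𝕜, exp (Y + s • X) = exp Y * exp (s • X) := fun s =>
    exp_add_of_commute_clm (h.smul_right s)
  have h1 := hasDerivAt_exp_smul_const (𝕂 := 𝕜) X t
  have h2 := (((ContinuousLinearMap.apply 𝕜 H u).comp
    (ContinuousLinearMap.mul 𝕜 (H →L[𝕜] H) (exp Y))).hasFDerivAt.comp_hasDerivAt t h1)
  simp only [e]
  exact h2

-- Since `X` commutes with its exponential, the orbit has derivative `X` applied to itself, and
-- Grönwall applies with rate `0`.
open NormedSpace in
theorem isContractive_of_re_inner_nonpos {X : H →L[𝕜] H}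
    (hX : ∀ u : H, RCLike.re ⟪X u, u⟫_𝕜 ≤ 0) : IsContractive X := by
  intro t ht u
  have hd : ∀ s : 𝕜, HasDerivAt (fun s : 𝕜 => exp (s • X) u) (exp (s • X) (X u)) s := fun s => by
    simpa using hasDerivAt_exp_add_smul_apply (Commute.zero_left X) u s
  have hc : Continuous fun s : ℝ => exp ((s : 𝕜) • X) u :=
    (continuous_iff_continuousAt.2 fun s => (hd s).continuousAt).comp RCLike.continuous_ofReal
  have key := norm_le_exp_mul_of_right_slope (𝕜 := 𝕜) (c := 0)
    (g := fun s : ℝ => exp ((s : 𝕜) • X) u) (g' := fun s : ℝ => exp ((s : 𝕜) • X) (X u)) hc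
    (fun s hs => ?_) (fun s hs => ?_) ht
  · simpa using key
  · have h1 := (hasDerivAt_iff_tendsto_slope_zero.1 (hd s))
    have h2 : Tendsto (fun h : ℝ => (h : 𝕜)) (𝓝[>] 0) (𝓝[≠] 0) := by
      refine tendsto_nhdsWithin_iff.2 ⟨?_, ?_⟩
      · have : Tendsto (fun h : ℝ => (h : 𝕜)) (𝓝 0) (𝓝 ((0 : ℝ) : 𝕜)) :=
          RCLike.continuous_ofReal.tendsto 0
        rw [RCLike.ofReal_zero] at this
        exact this.mono_left nhdsWithin_le_nhds
      · filter_upwards [self_mem_nhdsWithin] with y hy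
        simpa using ne_of_gt hy
    refine (h1.comp h2).congr fun h => ?_
    simp
  · have e : exp ((s : 𝕜) • X) (X u) = X (exp ((s : 𝕜) • X) u) := by
      have : Commute (exp ((s : 𝕜) • X)) X :=
        commute_exp_left ((Commute.refl X).smul_left (s : 𝕜))
      exact congrArg (fun T : H →L[𝕜] H => T u) this.eq
    rw [e, zero_mul]
    exact hX _

-- Interpolate along `s ↦ exp (t Y + s t (X - Y)) u`. By commutation its derivative is `exp ((1 - s)
-- t Y) exp (s t X)` applied to `t (X - Y) u`, and both exponentials are contractions.
open NormedSpace in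
theorem norm_exp_sub_exp_le {X Y : H →L[𝕜] H} (hXY : Commute X Y) (hX : IsContractive X)
    (hY : IsContractive Y) {t : ℝ} (ht : 0 ≤ t) (u : H) :
    ‖exp ((t : 𝕜) • X) u - exp ((t : 𝕜) • Y) u‖ ≤ t * ‖X u - Y u‖ := by
  let _ : InnerProductSpace ℝ H := InnerProductSpace.rclikeToReal 𝕜 H
  have : IsScalarTower ℝ 𝕜 H := ⟨fun a b x => by
    rw [RCLike.real_smul_eq_coe_smul (K := 𝕜) a (b • x), RCLike.real_smul_eq_coe_mul, mul_smul]⟩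
  have hcom : Commute ((t : 𝕜) • Y) ((t : 𝕜) • (X - Y)) :=
    ((hXY.symm.sub_right (Commute.refl Y)).smul_left _).smul_right _
  have hd : ∀ s : ℝ, HasDerivAt (fun s : ℝ => exp ((t : 𝕜) • Y + (s : 𝕜) • (t : 𝕜) • (X - Y)) u)
      (exp ((t : 𝕜) • Y + (s : 𝕜) • (t : 𝕜) • (X - Y)) (((t : 𝕜) • (X - Y)) u)) s := by
    intro s
    have h1 := hasDerivAt_exp_add_smul_apply hcom u (s : 𝕜)
    have h2 : HasDerivAt (fun s : ℝ => (s : 𝕜)) 1 s := by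
      have := (RCLike.ofRealCLM (K := 𝕜)).hasDerivAt (x := s)
      simpa using this
    simpa [Function.comp_def] using HasDerivAt.scomp s h1 h2
  have key := norm_image_sub_le_of_norm_deriv_le_segment_01' (C := t * ‖X u - Y u‖)
    (fun s _ => (hd s).hasDerivWithinAt) ?_
  · have e : (t : 𝕜) • Y + (t : 𝕜) • (X - Y) = (t : 𝕜) • X := by rw [smul_sub]; abel
    rw [RCLike.ofReal_one, one_smul, e, RCLike.ofReal_zero, zero_smul, add_zero] at key
    exact key
  · intro s hs
    have e : (t : 𝕜) • Y + (s : 𝕜) • (t : 𝕜) • (X - Y)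
        = (((1 - s) * t : ℝ) : 𝕜) • Y + ((s * t : ℝ) : 𝕜) • X := by
      push_cast
      simp only [smul_sub, smul_smul, sub_mul, one_mul, sub_smul]
      abel
    rw [e, exp_add_of_commute_clm ((hXY.symm.smul_left _).smul_right _)]
    refine (hY _ (mul_nonneg (by linarith [hs.2]) ht) _).trans
      ((hX _ (mul_nonneg hs.1 ht) _).trans ?_)
    rw [smul_apply, norm_smul, RCLike.norm_ofReal, abs_of_nonneg ht]
    rfl

open NormedSpace in
theorem norm_exp_sub_id_le {X : H →L[𝕜] H} (hX : IsContractive X) {t : ℝ} (ht : 0 ≤ t) (u : H) :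
    ‖exp ((t : 𝕜) • X) u - u‖ ≤ t * ‖X u‖ := by
  simpa using norm_exp_sub_exp_le (Commute.zero_right X) hX isContractive_zero ht u

-- A first-order Taylor estimate that avoids `X (X u)`, which has no limit when `X` approximates an
-- unbounded generator. The derivative of the remainder is `exp (s X) (X u) - X u`; replacing `X u`
-- by a free vector `y` costs `2 ‖X u - y‖`, and `y` itself moves by at most `s ‖X y‖`.
open NormedSpace in
theorem norm_exp_sub_id_sub_le {X : H →L[𝕜] H} (hX : IsContractive X) {t : ℝ} (ht : 0 ≤ t)
    (u y : H) :
    ‖exp ((t : 𝕜) • X) u - u - (t : 𝕜) • X u‖ ≤ t * (2 * ‖X u - y‖ + t * ‖X y‖) := by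
  let _ : InnerProductSpace ℝ H := InnerProductSpace.rclikeToReal 𝕜 H
  have : IsScalarTower ℝ 𝕜 H := ⟨fun a b x => by
    rw [RCLike.real_smul_eq_coe_smul (K := 𝕜) a (b • x), RCLike.real_smul_eq_coe_mul, mul_smul]⟩
  have hd : ∀ s : ℝ, HasDerivAt (fun s : ℝ => exp ((s : 𝕜) • X) u - (s : 𝕜) • X u)
      (exp ((s : 𝕜) • X) (X u) - X u) s := by
    intro s
    have h1 : HasDerivAt (fun s : 𝕜 => exp (s • X) u - s • X u)
        (exp ((s : 𝕜) • X) (X u) - X u) (s : 𝕜) := by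
      have h0 : HasDerivAt (fun s : 𝕜 => exp (s • X) u) (exp ((s : 𝕜) • X) (X u)) (s : 𝕜) := by
        simpa using hasDerivAt_exp_add_smul_apply (Commute.zero_left X) u (s : 𝕜)
      have h3 := h0.sub ((hasDerivAt_id (s : 𝕜)).smul_const (X u))
      rw [one_smul] at h3
      exact h3
    have h2 : HasDerivAt (fun s : ℝ => (s : 𝕜)) 1 s := by
      have := (RCLike.ofRealCLM (K := 𝕜)).hasDerivAt (x := s)
      simpa using this
    simpa [Function.comp_def] using HasDerivAt.scomp s h1 h2
  have key := norm_image_sub_le_of_norm_deriv_le_segment' (a := 0) (b := t)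
    (C := 2 * ‖X u - y‖ + t * ‖X y‖) (fun s _ => (hd s).hasDerivWithinAt) ?_ t
    (Set.right_mem_Icc.2 ht)
  · simp only [RCLike.ofReal_zero, zero_smul, exp_zero, sub_zero] at key
    rw [mul_comm] at key
    convert! key using 2
    simp only [one_apply_eq_self]
    abel
  · intro s hs
    have e : exp ((s : 𝕜) • X) (X u) - X u
        = exp ((s : 𝕜) • X) (X u - y) + (exp ((s : 𝕜) • X) y - y) - (X u - y) := by
      rw [map_sub]; abel
    have h1 := hX s hs.1 (X u - y)
    have h2 := norm_exp_sub_id_le hX hs.1 y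
    have h3 : s * ‖X y‖ ≤ t * ‖X y‖ := by gcongr; exact hs.2.le
    rw [e]
    linarith [norm_sub_le (exp ((s : 𝕜) • X) (X u - y) + (exp ((s : 𝕜) • X) y - y)) (X u - y),
      norm_add_le (exp ((s : 𝕜) • X) (X u - y)) (exp ((s : 𝕜) • X) y - y)]

end Semigroup

end ZeroRange

namespace ZeroRange

/-! ### The Hille–Yosida theorem by Yosida approximation. -/

section Yosida

variable {𝕜 H : Type*} [RCLike 𝕜] [NormedAddCommGroup H] [InnerProductSpace 𝕜 H]

/-- A densely defined maximal dissipative relation. -/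
structure IsMaximalDissipative (G : Submodule 𝕜 (H × H)) : Prop where
  dense : Dense {x : H | ∃ y, (x, y) ∈ G}
  bound : ∀ μ : ℝ, 0 < μ → ∀ p ∈ G, μ * ‖p.1‖ ≤ ‖(μ : 𝕜) • p.1 - p.2‖
  surj : ∀ μ : ℝ, 0 < μ → ∀ z : H, ∃ p ∈ G, (μ : 𝕜) • p.1 - p.2 = z

namespace IsMaximalDissipative

variable {G : Submodule 𝕜 (H × H)}

theorem fst_eq (hG : IsMaximalDissipative G) {μ : ℝ} (hμ : 0 < μ) {p q : H × H} (hp : p ∈ G)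
    (hq : q ∈ G) (h : (μ : 𝕜) • p.1 - p.2 = (μ : 𝕜) • q.1 - q.2) : p.1 = q.1 := by
  have h1 := hG.bound μ hμ _ (sub_mem hp hq)
  have h2 : (μ : 𝕜) • (p - q).1 - (p - q).2 = 0 := by
    rw [Prod.fst_sub, Prod.snd_sub, smul_sub]
    rw [← sub_eq_zero] at h
    rw [← h]; abel
  rw [h2, norm_zero] at h1
  have h3 : ‖(p - q).1‖ ≤ 0 := by
    by_contra hlt
    exact absurd h1 (not_le.2 (mul_pos hμ (not_le.1 hlt)))
  exact sub_eq_zero.1 (norm_le_zero_iff.1 h3)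

/-- The resolvent `(μ - G)⁻¹`. -/
noncomputable def resolvent (hG : IsMaximalDissipative G) {μ : ℝ} (hμ : 0 < μ) : H →L[𝕜] H :=
  LinearMap.mkContinuous
    -- The chosen solution is linear in `z` because `fst_eq` makes its first component unique.
    { toFun := fun z => (hG.surj μ hμ z).choose.1
      map_add' := fun x y => by
        have hx := (hG.surj μ hμ x).choose_spec
        have hy := (hG.surj μ hμ y).choose_spec
        have hxy := (hG.surj μ hμ (x + y)).choose_spec
        refine (hG.fst_eq hμ hxy.1 (add_mem hx.1 hy.1) ?_)
        rw [hxy.2, Prod.fst_add, Prod.snd_add, smul_add]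
        conv_lhs => rw [← hx.2, ← hy.2]
        abel
      map_smul' := fun c x => by
        have hx := (hG.surj μ hμ x).choose_spec
        have hcx := (hG.surj μ hμ (c • x)).choose_spec
        refine (hG.fst_eq hμ hcx.1 (Submodule.smul_mem _ c hx.1) ?_)
        rw [hcx.2, Prod.smul_fst, Prod.smul_snd, smul_comm, ← smul_sub, hx.2] }
    μ⁻¹ fun z => by
      have hz := (hG.surj μ hμ z).choose_spec
      have := hG.bound μ hμ _ hz.1
      rw [hz.2] at this
      rw [inv_mul_eq_div, le_div_iff₀ hμ, mul_comm]
      exact this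

theorem resolvent_apply (hG : IsMaximalDissipative G) {μ : ℝ} (hμ : 0 < μ) {p : H × H}
    (hp : p ∈ G) : hG.resolvent hμ ((μ : 𝕜) • p.1 - p.2) = p.1 := by
  have hz := (hG.surj μ hμ ((μ : 𝕜) • p.1 - p.2)).choose_spec
  exact hG.fst_eq hμ hz.1 hp hz.2

theorem resolvent_mem (hG : IsMaximalDissipative G) {μ : ℝ} (hμ : 0 < μ) (z : H) :
    (hG.resolvent hμ z, (μ : 𝕜) • hG.resolvent hμ z - z) ∈ G := by
  have hz := (hG.surj μ hμ z).choose_spec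
  have e : (hG.resolvent hμ z, (μ : 𝕜) • hG.resolvent hμ z - z)
      = (hG.surj μ hμ z).choose := by
    refine Prod.ext rfl ?_
    conv_lhs => rw [← hz.2]
    rw [hG.resolvent_apply hμ hz.1]
    simp
  rw [e]
  exact hz.1

theorem norm_resolvent_le (hG : IsMaximalDissipative G) {μ : ℝ} (hμ : 0 < μ) (z : H) :
    μ * ‖hG.resolvent hμ z‖ ≤ ‖z‖ := by
  simpa using hG.bound μ hμ _ (hG.resolvent_mem hμ z)

/-- The resolvent identity: with `a = R_ν z` and `b = R_μ a`, the vector `a - (μ - ν) b` equals `R_μ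
z`, and `R_ν` sends this same vector to `b`. -/
theorem commute_resolvent (hG : IsMaximalDissipative G) {μ ν : ℝ} (hμ : 0 < μ) (hν : 0 < ν) :
    Commute (hG.resolvent hμ) (hG.resolvent hν) := by
  refine ContinuousLinearMap.ext fun z => ?_
  change hG.resolvent hμ (hG.resolvent hν z) = hG.resolvent hν (hG.resolvent hμ z)
  set a := hG.resolvent hν z with ha
  set b := hG.resolvent hμ a with hb
  have h1 : (a, (ν : 𝕜) • a - z) ∈ G := hG.resolvent_mem hν z
  have h2 : (b, (μ : 𝕜) • b - a) ∈ G := hG.resolvent_mem hμ a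
  have h3 := hG.resolvent_apply hμ
    (sub_mem h1 (Submodule.smul_mem _ ((μ : 𝕜) - (ν : 𝕜)) h2))
  have e1 : (μ : 𝕜) • ((a, (ν : 𝕜) • a - z) - ((μ : 𝕜) - (ν : 𝕜)) • (b, (μ : 𝕜) • b - a)).1
      - ((a, (ν : 𝕜) • a - z) - ((μ : 𝕜) - (ν : 𝕜)) • (b, (μ : 𝕜) • b - a)).2 = z := by
    simp only [Prod.fst_sub, Prod.snd_sub, Prod.smul_mk]
    module
  rw [e1] at h3
  have h4 := hG.resolvent_apply hν (p := (b, (μ : 𝕜) • b - a)) h2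
  rw [h3, eq_comm]
  refine Eq.trans (congrArg _ ?_) h4
  simp only [Prod.fst_sub, Prod.smul_mk]
  module

/-- The Yosida approximation `μ² (μ - G)⁻¹ - μ`. -/
noncomputable def yosida (hG : IsMaximalDissipative G) {μ : ℝ} (hμ : 0 < μ) : H →L[𝕜] H :=
  ((μ ^ 2 : ℝ) : 𝕜) • hG.resolvent hμ - (μ : 𝕜) • (1 : H →L[𝕜] H)

theorem commute_yosida (hG : IsMaximalDissipative G) {μ ν : ℝ} (hμ : 0 < μ) (hν : 0 < ν) :
    Commute (hG.yosida hμ) (hG.yosida hν) := by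
  refine Commute.sub_right (Commute.sub_left ?_ ?_) (Commute.sub_left ?_ ?_)
  · exact ((hG.commute_resolvent hμ hν).smul_left _).smul_right _
  · exact ((Commute.one_left _).smul_left _).smul_right _
  · exact ((Commute.one_right _).smul_left _).smul_right _
  · exact ((Commute.one_right _).smul_left _).smul_right _

/-- By Cauchy–Schwarz and `μ ‖R u‖ ≤ ‖u‖`, the term `μ² Re ⟪R u, u⟫` is at most `μ ‖u‖²`. -/
theorem re_inner_yosida_nonpos (hG : IsMaximalDissipative G) {μ : ℝ} (hμ : 0 < μ) (u : H) :
    RCLike.re ⟪hG.yosida hμ u, u⟫_𝕜 ≤ 0 := by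
  have e : hG.yosida hμ u = ((μ ^ 2 : ℝ) : 𝕜) • hG.resolvent hμ u - (μ : 𝕜) • u := rfl
  rw [e, inner_sub_left, inner_smul_left, inner_smul_left, RCLike.conj_ofReal,
    RCLike.conj_ofReal, map_sub, RCLike.re_ofReal_mul, RCLike.re_ofReal_mul, inner_self_eq_norm_sq]
  have h1 := re_inner_le_norm (𝕜 := 𝕜) (hG.resolvent hμ u) u
  have h2 := mul_le_mul_of_nonneg_right (hG.norm_resolvent_le hμ u) (norm_nonneg u)
  have h3 := mul_le_mul_of_nonneg_left h1 (sq_nonneg μ)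
  have h4 := mul_le_mul_of_nonneg_left h2 hμ.le
  nlinarith

theorem yosida_apply (hG : IsMaximalDissipative G) {μ : ℝ} (hμ : 0 < μ) {p : H × H}
    (hp : p ∈ G) : hG.yosida hμ p.1 = (μ : 𝕜) • hG.resolvent hμ p.2 := by
  have h := hG.resolvent_apply hμ hp
  rw [map_sub, map_smul, sub_eq_iff_eq_add] at h
  have e : hG.yosida hμ p.1 = ((μ ^ 2 : ℝ) : 𝕜) • hG.resolvent hμ p.1 - (μ : 𝕜) • p.1 := rfl
  rw [e, pow_two, RCLike.ofReal_mul, mul_smul, h, smul_add]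
  abel

/-- The sequence of Yosida approximations. -/
noncomputable def yosidaSeq (hG : IsMaximalDissipative G) (n : ℕ) : H →L[𝕜] H :=
  -- The shift keeps the parameter positive at `n = 0`.
  hG.yosida (μ := (n : ℝ) + 1) (by positivity)

theorem exists_norm_sub_lt (hG : IsMaximalDissipative G) (x : H) {ε : ℝ} (hε : 0 < ε) :
    ∃ p ∈ G, ‖x - p.1‖ < ε := by
  obtain ⟨u, ⟨v, hv⟩, hu⟩ := Metric.dense_iff.1 hG.dense x ε hε |>.imp fun _ h => h.symm
  exact ⟨(u, v), hv, by rwa [← dist_eq_norm, dist_comm]⟩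

/-- By `yosida_apply` the claim is `μ R p.2 → p.2`. For `q ∈ G`, `μ R q.1 - q.1 = R q.2` has norm at
most `‖q.2‖ / μ`; the contractions `μ R` allow `p.2` to be approximated by such `q.1`. -/
theorem tendsto_yosidaSeq (hG : IsMaximalDissipative G) {p : H × H} (hp : p ∈ G) :
    Tendsto (fun n => hG.yosidaSeq n p.1) atTop (𝓝 p.2) := by
  have hpos : ∀ n : ℕ, (0 : ℝ) < (n : ℝ) + 1 := fun n => by positivity
  rw [Metric.tendsto_atTop]
  intro ε hε
  obtain ⟨q, hq, hpq⟩ := hG.exists_norm_sub_lt p.2 (ε := ε / 4) (by positivity)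
  obtain ⟨N, hN⟩ := exists_nat_gt (‖q.2‖ / (ε / 4))
  refine ⟨N, fun n hn => ?_⟩
  have hn' : ‖q.2‖ / (ε / 4) < (n : ℝ) + 1 := by
    have : (N : ℝ) ≤ n := by exact_mod_cast hn
    linarith
  rw [div_lt_iff₀ (by positivity)] at hn'
  set R := hG.resolvent (hpos n) with hR
  have e1 : hG.yosidaSeq n p.1 = (((n : ℝ) + 1 : ℝ) : 𝕜) • R p.2 := hG.yosida_apply (hpos n) hp
  have e2 : (((n : ℝ) + 1 : ℝ) : 𝕜) • R q.1 - q.1 = R q.2 := by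
    have h := hG.resolvent_apply (hpos n) hq
    rw [map_sub, map_smul, sub_eq_iff_eq_add] at h
    rw [h]; abel
  have e3 : hG.yosidaSeq n p.1 - p.2
      = (((n : ℝ) + 1 : ℝ) : 𝕜) • R (p.2 - q.1) + R q.2 - (p.2 - q.1) := by
    rw [e1, ← e2, map_sub, smul_sub]; abel
  have h1 : ‖(((n : ℝ) + 1 : ℝ) : 𝕜) • R (p.2 - q.1)‖ ≤ ‖p.2 - q.1‖ := by
    rw [norm_smul, RCLike.norm_ofReal, abs_of_pos (hpos n)]
    exact hG.norm_resolvent_le (hpos n) _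
  have h2 : ‖R q.2‖ < ε / 4 := by
    have := hG.norm_resolvent_le (hpos n) q.2
    have h3 := hpos n
    by_contra hcon
    rw [not_lt] at hcon
    have := mul_le_mul_of_nonneg_left hcon h3.le
    linarith
  rw [dist_eq_norm, e3]
  have h5 := norm_sub_le ((((n : ℝ) + 1 : ℝ) : 𝕜) • R (p.2 - q.1) + R q.2) (p.2 - q.1)
  have h6 := norm_add_le ((((n : ℝ) + 1 : ℝ) : 𝕜) • R (p.2 - q.1)) (R q.2)
  linarith

variable [CompleteSpace H]

theorem isContractive_yosidaSeq (hG : IsMaximalDissipative G) (n : ℕ) :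
    IsContractive (hG.yosidaSeq n) :=
  isContractive_of_re_inner_nonpos (hG.re_inner_yosida_nonpos _)

/-- On the domain, `norm_exp_sub_exp_le` reduces this to convergence of the commuting Yosida
approximations; contractivity extends it to all `x`. -/
theorem cauchySeq_exp_yosidaSeq (hG : IsMaximalDissipative G) {t : ℝ} (ht : 0 ≤ t) (x : H) :
    CauchySeq fun n => NormedSpace.exp ((t : 𝕜) • hG.yosidaSeq n) x := by
  rw [Metric.cauchySeq_iff]
  intro ε hε
  obtain ⟨p, hp, hpx⟩ := hG.exists_norm_sub_lt x (ε := ε / 4) (by positivity)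
  obtain ⟨N, hN⟩ := Metric.cauchySeq_iff.1 (hG.tendsto_yosidaSeq hp).cauchySeq
    (ε / 4 / (t + 1)) (by positivity)
  refine ⟨N, fun m hm n hn => ?_⟩
  have h1 := norm_exp_sub_exp_le (hG.commute_yosida (by positivity) (by positivity))
    (hG.isContractive_yosidaSeq m) (hG.isContractive_yosidaSeq n) ht p.1
  have h2 := hN m hm n hn
  rw [dist_eq_norm, lt_div_iff₀ (by positivity)] at h2
  have h3 := hG.isContractive_yosidaSeq m t ht (x - p.1)
  have h4 := hG.isContractive_yosidaSeq n t ht (x - p.1)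
  set E := NormedSpace.exp ((t : 𝕜) • hG.yosidaSeq m) with hE
  set F := NormedSpace.exp ((t : 𝕜) • hG.yosidaSeq n) with hF
  have e : E x - F x = E (x - p.1) + (E p.1 - F p.1) - F (x - p.1) := by
    rw [map_sub, map_sub]; abel
  rw [dist_eq_norm, e]
  have h5 := norm_sub_le (E (x - p.1) + (E p.1 - F p.1)) (F (x - p.1))
  have h6 := norm_add_le (E (x - p.1)) (E p.1 - F p.1)
  have h7 : ‖E p.1 - F p.1‖ ≤ t * ‖hG.yosidaSeq m p.1 - hG.yosidaSeq n p.1‖ := h1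
  have h8 := norm_nonneg (hG.yosidaSeq m p.1 - hG.yosidaSeq n p.1)
  nlinarith

theorem exists_tendsto_exp (hG : IsMaximalDissipative G) (t : ℝ≥0) :
    ∃ S : H →L[𝕜] H, ∀ x,
      Tendsto (fun n => NormedSpace.exp (((t : ℝ) : 𝕜) • hG.yosidaSeq n) x) atTop (𝓝 (S x)) := by
  choose f hf using fun x => cauchySeq_tendsto_of_complete (hG.cauchySeq_exp_yosidaSeq t.2 x)
  -- The pointwise limit is bounded by Banach–Steinhaus.
  exact ⟨continuousLinearMapOfTendsto _ (tendsto_pi_nhds.2 hf), hf⟩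

/-- The contraction semigroup generated by a maximal dissipative relation. -/
noncomputable def semigroup (hG : IsMaximalDissipative G) (t : ℝ≥0) : H →L[𝕜] H :=
  (hG.exists_tendsto_exp t).choose

theorem tendsto_semigroup (hG : IsMaximalDissipative G) (t : ℝ≥0) (x : H) :
    Tendsto (fun n => NormedSpace.exp (((t : ℝ) : 𝕜) • hG.yosidaSeq n) x) atTop
      (𝓝 (hG.semigroup t x)) :=
  (hG.exists_tendsto_exp t).choose_spec x

theorem norm_semigroup_le (hG : IsMaximalDissipative G) (t : ℝ≥0) (x : H) :
    ‖hG.semigroup t x‖ ≤ ‖x‖ :=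
  le_of_tendsto (hG.tendsto_semigroup t x).norm
    (Eventually.of_forall fun n => hG.isContractive_yosidaSeq n t t.2 x)

theorem semigroup_zero (hG : IsMaximalDissipative G) :
    hG.semigroup 0 = ContinuousLinearMap.id 𝕜 H := by
  refine ContinuousLinearMap.ext fun x => tendsto_nhds_unique (hG.tendsto_semigroup 0 x) ?_
  simp

theorem semigroup_add (hG : IsMaximalDissipative G) (s t : ℝ≥0) :
    hG.semigroup (s + t) = (hG.semigroup s).comp (hG.semigroup t) := by
  refine ContinuousLinearMap.ext fun x => tendsto_nhds_unique (hG.tendsto_semigroup _ x) ?_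
  have h1 := hG.tendsto_semigroup t x
  have h2 := hG.tendsto_semigroup s (hG.semigroup t x)
  -- Both factors vary with `n`; the error of the inner factor is isolated so that contractivity of
  -- the outer one sends it to `0`.
  have e : ∀ n, NormedSpace.exp ((((s + t : ℝ≥0) : ℝ) : 𝕜) • hG.yosidaSeq n) x
      = NormedSpace.exp (((s : ℝ) : 𝕜) • hG.yosidaSeq n)
        (NormedSpace.exp (((t : ℝ) : 𝕜) • hG.yosidaSeq n) x - hG.semigroup t x)
        + NormedSpace.exp (((s : ℝ) : 𝕜) • hG.yosidaSeq n) (hG.semigroup t x) := by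
    intro n
    rw [NNReal.coe_add, RCLike.ofReal_add, add_smul, exp_add_of_commute_clm
      (((Commute.refl _).smul_left _).smul_right _), map_sub, sub_add_cancel]
    rfl
  simp only [e]
  have h3 : Tendsto (fun n => NormedSpace.exp (((s : ℝ) : 𝕜) • hG.yosidaSeq n)
        (NormedSpace.exp (((t : ℝ) : 𝕜) • hG.yosidaSeq n) x - hG.semigroup t x)) atTop (𝓝 0) :=
    squeeze_zero_norm (fun n => hG.isContractive_yosidaSeq n s s.2 _)
      (tendsto_iff_norm_sub_tendsto_zero.1 h1)
  simpa using h3.add h2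

theorem norm_semigroup_sub_id_le (hG : IsMaximalDissipative G) (t : ℝ≥0) {p : H × H}
    (hp : p ∈ G) : ‖hG.semigroup t p.1 - p.1‖ ≤ t * ‖p.2‖ :=
  le_of_tendsto_of_tendsto ((hG.tendsto_semigroup t p.1).sub_const p.1).norm
    ((hG.tendsto_yosidaSeq hp).norm.const_mul (t : ℝ))
    (Eventually.of_forall fun n => norm_exp_sub_id_le (hG.isContractive_yosidaSeq n) t.2 p.1)

theorem norm_semigroup_sub_id_sub_le (hG : IsMaximalDissipative G) (t : ℝ≥0) {p q : H × H}
    (hp : p ∈ G) (hq : q ∈ G) :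
    ‖hG.semigroup t p.1 - p.1 - ((t : ℝ) : 𝕜) • p.2‖ ≤
      t * (2 * ‖p.2 - q.1‖ + t * ‖q.2‖) := by
  have h1 := hG.tendsto_yosidaSeq hp
  refine le_of_tendsto_of_tendsto
    (((hG.tendsto_semigroup t p.1).sub_const p.1).sub (h1.const_smul ((t : ℝ) : 𝕜))).norm
    ((((h1.sub_const q.1).norm.const_mul 2).add
      ((hG.tendsto_yosidaSeq hq).norm.const_mul (t : ℝ))).const_mul (t : ℝ))
    (Eventually.of_forall fun n => ?_)
  exact norm_exp_sub_id_sub_le (hG.isContractive_yosidaSeq n) t.2 p.1 q.1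

theorem norm_semigroup_sub_semigroup_le (hG : IsMaximalDissipative G) (s t : ℝ≥0) (x : H)
    {p : H × H} (hp : p ∈ G) :
    ‖hG.semigroup s x - hG.semigroup t x‖ ≤ 2 * ‖x - p.1‖ + dist s t * ‖p.2‖ := by
  wlog hst : t ≤ s generalizing s t
  · rw [norm_sub_rev, dist_comm]
    exact this t s (le_of_not_ge hst)
  obtain ⟨r, rfl⟩ := exists_add_of_le hst
  have e : hG.semigroup (t + r) x - hG.semigroup t x
      = hG.semigroup t (hG.semigroup r (x - p.1) + (hG.semigroup r p.1 - p.1) - (x - p.1)) := by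
    rw [hG.semigroup_add, ContinuousLinearMap.comp_apply, ← map_sub, map_sub (hG.semigroup r)]
    congr 1; abel
  have hd : dist (t + r) t = r := by simp [NNReal.dist_eq]
  rw [e, hd]
  refine (hG.norm_semigroup_le _ _).trans ?_
  have h1 := hG.norm_semigroup_le r (x - p.1)
  have h2 := hG.norm_semigroup_sub_id_le r hp
  linarith [norm_sub_le (hG.semigroup r (x - p.1) + (hG.semigroup r p.1 - p.1)) (x - p.1),
    norm_add_le (hG.semigroup r (x - p.1)) (hG.semigroup r p.1 - p.1)]

theorem continuous_semigroup (hG : IsMaximalDissipative G) (x : H) :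
    Continuous fun t => hG.semigroup t x := by
  rw [Metric.continuous_iff]
  intro t ε hε
  obtain ⟨p, hp, hpx⟩ := hG.exists_norm_sub_lt x (ε := ε / 4) (by positivity)
  refine ⟨ε / 4 / (‖p.2‖ + 1), by positivity, fun s hs => ?_⟩
  rw [lt_div_iff₀ (by positivity)] at hs
  have h := hG.norm_semigroup_sub_semigroup_le s t x hp
  rw [dist_eq_norm]
  have := dist_nonneg (x := s) (y := t)
  nlinarith

/-- Dividing `norm_semigroup_sub_id_sub_le` by `t` leaves `2 ‖p.2 - q.1‖ + t ‖q.2‖`: choose `q.1`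
near `p.2` by density, then `t` small. -/
theorem tendsto_slope_of_mem (hG : IsMaximalDissipative G) {p : H × H} (hp : p ∈ G) :
    Tendsto (fun t : ℝ≥0 => (((t : ℝ) : 𝕜)⁻¹) • (hG.semigroup t p.1 - p.1)) (𝓝[>] 0)
      (𝓝 p.2) := by
  rw [Metric.tendsto_nhdsWithin_nhds]
  intro ε hε
  obtain ⟨q, hq, hpq⟩ := hG.exists_norm_sub_lt p.2 (ε := ε / 4) (by positivity)
  refine ⟨ε / 4 / (‖q.2‖ + 1), by positivity, fun t ht hs => ?_⟩
  have ht' : (0 : ℝ) < t := NNReal.coe_pos.2 ht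
  rw [NNReal.dist_eq, NNReal.coe_zero, sub_zero, abs_of_pos ht', lt_div_iff₀ (by positivity)] at hs
  have h := hG.norm_semigroup_sub_id_sub_le t hp hq
  have ht0 : ((t : ℝ) : 𝕜) ≠ 0 := RCLike.ofReal_ne_zero.2 ht'.ne'
  have e : (((t : ℝ) : 𝕜)⁻¹) • (hG.semigroup t p.1 - p.1) - p.2
      = (((t : ℝ) : 𝕜)⁻¹) • (hG.semigroup t p.1 - p.1 - ((t : ℝ) : 𝕜) • p.2) := by
    rw [smul_sub _ _ (((t : ℝ) : 𝕜) • p.2), inv_smul_smul₀ ht0]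
  rw [dist_eq_norm, e, norm_smul, norm_inv, RCLike.norm_ofReal, abs_of_pos ht', inv_mul_eq_div,
    div_lt_iff₀ ht']
  refine h.trans_lt ?_
  rw [mul_comm]
  refine mul_lt_mul_of_pos_right ?_ ht'
  nlinarith [norm_nonneg q.2]

/-- Conversely, the generator extends `G` and is dissipative because the semigroup contracts. As `1
- G` is already onto, some `p ∈ G` has the same image as `(u, v)`, and dissipativity forces `p = (u,
v)`. -/
theorem mem_iff_tendsto_slope (hG : IsMaximalDissipative G) (u v : H) :
    (u, v) ∈ G ↔ Tendsto (fun t : ℝ≥0 => (((t : ℝ) : 𝕜)⁻¹) • (hG.semigroup t u - u)) (𝓝[>] 0)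
      (𝓝 v) := by
  refine ⟨fun h => hG.tendsto_slope_of_mem h, fun h => ?_⟩
  obtain ⟨p, hp, hpz⟩ := hG.surj 1 one_pos (u - v)
  rw [RCLike.ofReal_one, one_smul] at hpz
  have h1 := h.sub (hG.tendsto_slope_of_mem hp)
  have hv : v - p.2 = u - p.1 := by
    have e : v - p.2 = (p.1 - p.2) - p.1 + v := by abel
    rw [e, hpz]; abel
  rw [hv] at h1
  have h2 : RCLike.re ⟪u - p.1, u - p.1⟫_𝕜 ≤ 0 := by
    refine le_of_tendsto ((RCLike.continuous_re.tendsto _).comp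
      (h1.inner (𝕜 := 𝕜) (tendsto_const_nhds (x := u - p.1)))) ?_
    filter_upwards [self_mem_nhdsWithin] with t ht
    have ht' : (0 : ℝ) < t := NNReal.coe_pos.2 ht
    rw [Function.comp_apply, ← smul_sub, inner_smul_left, ← RCLike.ofReal_inv,
      RCLike.conj_ofReal, RCLike.re_ofReal_mul]
    refine mul_nonpos_of_nonneg_of_nonpos (by positivity) ?_
    have e : hG.semigroup t u - u - (hG.semigroup t p.1 - p.1)
        = hG.semigroup t (u - p.1) - (u - p.1) := by rw [map_sub]; abel
    rw [e, inner_sub_left, map_sub, inner_self_eq_norm_sq]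
    have h3 := re_inner_le_norm (𝕜 := 𝕜) (hG.semigroup t (u - p.1)) (u - p.1)
    have h4 := mul_le_mul_of_nonneg_right (hG.norm_semigroup_le t (u - p.1))
      (norm_nonneg (u - p.1))
    nlinarith
  rw [inner_self_eq_norm_sq] at h2
  have h5 : u - p.1 = 0 := by
    rw [← norm_eq_zero]
    exact pow_eq_zero_iff two_ne_zero |>.1 (le_antisymm h2 (by positivity))
  rw [h5] at hv
  rw [sub_eq_zero.1 h5, sub_eq_zero.1 hv]
  exact hp

end IsMaximalDissipative

variable [CompleteSpace H]

/-- A self-adjoint operator bounded above by `c` generates a strongly continuous semigroup. -/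
theorem exists_isSemigroupGeneratedBy {A : H →ₗ.[𝕜] H} (hA : IsSelfAdjoint A) {c : ℝ}
    (hc : ∀ p ∈ A.graph, RCLike.re ⟪p.2, p.1⟫_𝕜 ≤ c * ‖p.1‖ ^ 2) :
    ∃ Q : ℝ≥0 → H →L[𝕜] H, IsSemigroupGeneratedBy A Q := by
  -- Pulling the graph of `A` back along this shear gives the graph of `A - c`.
  set T : H × H →ₗ[𝕜] H × H :=
    LinearMap.prod (LinearMap.fst 𝕜 H H) (LinearMap.snd 𝕜 H H + (c : 𝕜) • LinearMap.fst 𝕜 H H)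
    with hT
  set G : Submodule 𝕜 (H × H) := A.graph.comap T with hGdef
  have hmem : ∀ u v, (u, v) ∈ G ↔ (u, v + (c : 𝕜) • u) ∈ A.graph := fun u v => Iff.rfl
  have hbound : ∀ μ : ℝ, c < μ → ∀ p ∈ A.graph, (μ - c) * ‖p.1‖ ≤ ‖(μ : 𝕜) • p.1 - p.2‖ :=
    fun μ _ p hp => mul_norm_le_norm_smul_sub (hc p hp)
  have hG : IsMaximalDissipative G := by
    refine ⟨hA.dense_domain.mono fun x hx => ?_, fun μ hμ p hp => ?_, fun μ hμ z => ?_⟩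
    · obtain ⟨y, hy⟩ := LinearPMap.mem_domain_iff.1 hx
      refine ⟨y - (c : 𝕜) • x, (hmem _ _).2 ?_⟩
      rwa [sub_add_cancel]
    · have := hbound (μ + c) (by linarith) _ ((hmem p.1 p.2).1 hp)
      rw [add_sub_cancel_right, RCLike.ofReal_add, add_smul, add_sub_add_right_eq_sub] at this
      exact this
    · obtain ⟨p, hp, hpz⟩ := exists_mem_smul_sub_eq hA.isClosed (μ := μ + c) (m := μ) hμ
        (fun p hp => by simpa using hbound (μ + c) (by linarith) p hp) (z := z) fun v hv => by
          -- A vector orthogonal to the range of `μ + c - A` is an eigenvector of `A† = A` with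
          -- eigenvalue above `c`, which the form bound excludes unless it is `0`.
          have h1 : (v, ((μ + c : ℝ) : 𝕜) • v) ∈ A.graph := by
            rw [← LinearPMap.isSelfAdjoint_def.1 hA, mem_adjoint_graph_iff hA.dense_domain]
            intro q hq
            rw [hv q hq, inner_smul_left, RCLike.conj_ofReal]
          have h2 := hbound (μ + c) (by linarith) _ h1
          rw [sub_self, norm_zero, add_sub_cancel_right] at h2
          have h3 : ‖v‖ ≤ 0 := by
            by_contra hlt
            exact absurd h2 (not_le.2 (mul_pos hμ (not_le.1 hlt)))
          rw [norm_le_zero_iff.1 h3, inner_zero_left]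
      refine ⟨(p.1, p.2 - (c : 𝕜) • p.1), (hmem _ _).2 (by rwa [sub_add_cancel]), ?_⟩
      rw [← hpz, RCLike.ofReal_add]
      module
  -- The factor `exp (c t)` restores the shift by `c`; the generator is then computed by the product
  -- rule at `t = 0`.
  refine ⟨fun t => ((Real.exp (c * t) : ℝ) : 𝕜) • hG.semigroup t, ?_, ?_, ?_, ?_⟩
  · simp [hG.semigroup_zero]
  · intro s t
    ext x
    simp only [hG.semigroup_add, smul_apply, ContinuousLinearMap.comp_apply, map_smul, smul_smul,
      ← RCLike.ofReal_mul, ← Real.exp_add, NNReal.coe_add, mul_add, add_comm (c * (s : ℝ))]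
  · intro u
    have := hG.continuous_semigroup u
    have h2 : Continuous fun t : ℝ≥0 => ((Real.exp (c * t) : ℝ) : 𝕜) :=
      RCLike.continuous_ofReal.comp (by fun_prop)
    exact h2.smul this
  · intro u v
    have h0 : (u, v) ∈ A.graph ↔ (u, v - (c : 𝕜) • u) ∈ G := by rw [hmem, sub_add_cancel]
    rw [h0, hG.mem_iff_tendsto_slope]
    have he : Tendsto (fun t : ℝ≥0 => ((Real.exp (c * t) : ℝ) : 𝕜)) (𝓝[>] 0) (𝓝 1) := by
      have : Continuous fun t : ℝ≥0 => ((Real.exp (c * t) : ℝ) : 𝕜) :=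
        RCLike.continuous_ofReal.comp (by fun_prop)
      simpa using (this.tendsto 0).mono_left (nhdsWithin_le_nhds (s := Set.Ioi 0))
    have hs : Tendsto (fun t : ℝ≥0 => (((t : ℝ) : 𝕜)⁻¹) * (((Real.exp (c * t) : ℝ) : 𝕜) - 1))
        (𝓝[>] 0) (𝓝 (c : 𝕜)) := by
      have h1 : HasDerivAt (fun t : ℝ => Real.exp (c * t)) c 0 := by
        simpa using ((hasDerivAt_id (0 : ℝ)).const_mul c).exp
      have h2 := (hasDerivAt_iff_tendsto_slope_zero.1 h1).mono_left
        (nhdsWithin_mono 0 (fun x (hx : 0 < x) => hx.ne'))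
      have h3 := (RCLike.continuous_ofReal (K := 𝕜)).tendsto c |>.comp
        (h2.comp tendsto_coe_nhdsGT_zero)
      refine h3.congr fun t => ?_
      simp
    have e : ∀ t : ℝ≥0, (((t : ℝ) : 𝕜)⁻¹) •
        ((((Real.exp (c * t) : ℝ) : 𝕜) • hG.semigroup t) u - u)
        = ((Real.exp (c * t) : ℝ) : 𝕜) • (((t : ℝ) : 𝕜)⁻¹) • (hG.semigroup t u - u)
          + ((((t : ℝ) : 𝕜)⁻¹) * (((Real.exp (c * t) : ℝ) : 𝕜) - 1)) • u := by
      intro t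
      rw [smul_apply]
      module
    simp only [e]
    constructor
    · intro h
      simpa using (he.smul h).add (hs.smul_const u)
    · intro h
      have h1 := h.sub (hs.smul_const u)
      simp only [add_sub_cancel_right] at h1
      have h2 := (he.inv₀ one_ne_zero).smul h1
      rw [inv_one, one_smul] at h2
      refine h2.congr fun t => ?_
      rw [inv_smul_smul₀ (RCLike.ofReal_ne_zero.2 (Real.exp_ne_zero _))]

end Yosida

end ZeroRange

namespace ZeroRange

/-! ### Cutting off Schwartz functions near the origin and infinity. -/

section Cutoff

open scoped SchwartzMap LineDeriv Laplacian

/-- The pointwise product of two real Schwartz functions. -/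
noncomputable def schwartzMul (f g : 𝓢(R3, ℝ)) : 𝓢(R3, ℝ) :=
  SchwartzMap.pairing (ContinuousLinearMap.mul ℝ ℝ) f g

@[simp]
theorem schwartzMul_apply (f g : 𝓢(R3, ℝ)) (x : R3) : schwartzMul f g x = f x * g x := rfl

/-- The `i`-th partial derivative of a Schwartz function. -/
noncomputable abbrev partialDeriv (i : Fin 3) (f : 𝓢(R3, ℝ)) : 𝓢(R3, ℝ) :=
  ∂_{EuclideanSpace.basisFun (Fin 3) ℝ i} f

theorem laplacian_eq_sum_partialDeriv (f : 𝓢(R3, ℝ)) :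
    Δ f = ∑ i, partialDeriv i (partialDeriv i f) :=
  SchwartzMap.laplacian_eq_sum _ f

theorem partialDeriv_mul (i : Fin 3) (f g : 𝓢(R3, ℝ)) :
    partialDeriv i (schwartzMul f g)
      = schwartzMul (partialDeriv i f) g + schwartzMul f (partialDeriv i g) := by
  ext x
  have h : HasFDerivAt (schwartzMul f g) (f x • fderiv ℝ g x + g x • fderiv ℝ f x) x :=
    (f.hasFDerivAt x).mul (g.hasFDerivAt x)
  simp only [SchwartzMap.lineDerivOp_apply_eq_fderiv, add_apply, schwartzMul_apply, h.fderiv,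
    smul_apply, smul_eq_mul]
  ring

theorem partialDeriv_sub (i : Fin 3) (f g : 𝓢(R3, ℝ)) :
    partialDeriv i (f - g) = partialDeriv i f - partialDeriv i g := by
  ext x
  have h : HasFDerivAt (f - g : 𝓢(R3, ℝ)) (fderiv ℝ f x - fderiv ℝ g x) x :=
    (f.hasFDerivAt x).sub (g.hasFDerivAt x)
  simp only [SchwartzMap.lineDerivOp_apply_eq_fderiv, sub_apply, h.fderiv]

/-- The operator `μ - ½ Δ` on Schwartz functions. -/
noncomputable def helmholtz (μ : ℝ) (f : 𝓢(R3, ℝ)) : 𝓢(R3, ℝ) := μ • f - (1 / 2 : ℝ) • Δ f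

theorem helmholtz_apply (μ : ℝ) (f : 𝓢(R3, ℝ)) (x : R3) :
    helmholtz μ f x = μ * f x - 1 / 2 * Δ f x := rfl

theorem helmholtz_mul (μ : ℝ) (f g : 𝓢(R3, ℝ)) (x : R3) :
    helmholtz μ (schwartzMul f g) x = g x * helmholtz μ f x
      - ∑ i, partialDeriv i f x * partialDeriv i g x - 1 / 2 * (f x * Δ g x) := by
  have h : ∀ i, partialDeriv i (partialDeriv i (schwartzMul f g)) x
      = partialDeriv i (partialDeriv i f) x * g x + 2 * (partialDeriv i f x * partialDeriv i g x)
        + f x * partialDeriv i (partialDeriv i g) x := by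
    intro i
    rw [partialDeriv_mul, partialDeriv, LineDeriv.lineDerivOp_add, ← partialDeriv, ← partialDeriv,
      partialDeriv_mul, partialDeriv_mul]
    simp only [add_apply, schwartzMul_apply]
    ring
  simp only [helmholtz_apply, laplacian_eq_sum_partialDeriv, sum_apply, h, schwartzMul_apply]
  simp only [Fin.sum_univ_three]
  ring

theorem laplacian_congr_of_eventuallyEq_const {f : 𝓢(R3, ℝ)} {x : R3} {c : ℝ}
    (h : f =ᶠ[𝓝 x] fun _ => c) : Δ f x = 0 := by
  rw [SchwartzMap.laplacian_apply, (InnerProductSpace.laplacian_congr_nhds h).eq_of_nhds,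
    InnerProductSpace.laplacian_const]
  rfl

theorem partialDeriv_eq_zero_of_eventuallyEq_const {f : 𝓢(R3, ℝ)} {x : R3} {c : ℝ} (i : Fin 3)
    (h : f =ᶠ[𝓝 x] fun _ => c) : partialDeriv i f x = 0 := by
  rw [SchwartzMap.lineDerivOp_apply_eq_fderiv, h.fderiv_eq]
  simp

/-- A smooth bump equal to `1` on the unit ball and supported in the ball of radius `2`. -/
noncomputable def bump : ContDiffBump (0 : R3) := ⟨1, 2, one_pos, one_lt_two⟩

/-- The bump function as a Schwartz function. -/
noncomputable def bumpSchwartz : 𝓢(R3, ℝ) := bump.hasCompactSupport.toSchwartzMap bump.contDiff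

theorem bumpSchwartz_apply (x : R3) : bumpSchwartz x = bump x := rfl

theorem bumpSchwartz_of_le {x : R3} (hx : ‖x‖ ≤ 1) : bumpSchwartz x = 1 :=
  bump.one_of_mem_closedBall (by simpa [bump] using hx)

theorem bumpSchwartz_of_ge {x : R3} (hx : 2 ≤ ‖x‖) : bumpSchwartz x = 0 :=
  bump.zero_of_le_dist (by simpa [bump] using hx)

/-- Dilation of a Schwartz function by a positive factor. -/
noncomputable def dilate {a : ℝ} (ha : 0 < a) (f : 𝓢(R3, ℝ)) : 𝓢(R3, ℝ) :=
  SchwartzMap.compCLMOfContinuousLinearEquiv ℝ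
    (ContinuousLinearEquiv.smulLeft (R₁ := ℝ) (M₁ := R3) (Units.mk0 a ha.ne')) f

theorem dilate_apply {a : ℝ} (ha : 0 < a) (f : 𝓢(R3, ℝ)) (x : R3) :
    dilate ha f x = f (a • x) := rfl

theorem partialDeriv_dilate {a : ℝ} (ha : 0 < a) (f : 𝓢(R3, ℝ)) (i : Fin 3) :
    partialDeriv i (dilate ha f) = a • dilate ha (partialDeriv i f) := by
  rw [partialDeriv, dilate, SchwartzMap.lineDerivOp_compCLMOfContinuousLinearEquiv]
  change SchwartzMap.compCLMOfContinuousLinearEquiv ℝ _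
    (∂_{a • EuclideanSpace.basisFun (Fin 3) ℝ i} f) = _
  rw [LineDeriv.lineDerivOp_left_smul, map_smul]
  rfl

theorem laplacian_dilate {a : ℝ} (ha : 0 < a) (f : 𝓢(R3, ℝ)) (x : R3) :
    Δ (dilate ha f) x = a ^ 2 * Δ f (a • x) := by
  have h : ∀ i, partialDeriv i (partialDeriv i (dilate ha f)) x
      = a ^ 2 * partialDeriv i (partialDeriv i f) (a • x) := by
    intro i
    rw [partialDeriv_dilate, partialDeriv, LineDeriv.lineDerivOp_smul, ← partialDeriv,
      partialDeriv_dilate]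
    simp only [smul_apply, smul_eq_mul, dilate_apply]
    ring
  simp only [laplacian_eq_sum_partialDeriv, sum_apply, h, Finset.mul_sum]

/-- A smooth function equal to `1` on the annulus `2 / (n + 2) ≤ ‖x‖ ≤ n + 2` and vanishing near the
origin and near infinity. -/
noncomputable def annulus (n : ℕ) : 𝓢(R3, ℝ) :=
  dilate (a := ((n : ℝ) + 2)⁻¹) (by positivity) bumpSchwartz
    - dilate (a := (n : ℝ) + 2) (by positivity) bumpSchwartz

theorem annulus_apply (n : ℕ) (x : R3) :
    annulus n x = bumpSchwartz (((n : ℝ) + 2)⁻¹ • x) - bumpSchwartz (((n : ℝ) + 2) • x) := rfl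

theorem abs_annulus_le (n : ℕ) (x : R3) : |annulus n x| ≤ 1 := by
  rw [annulus_apply, bumpSchwartz_apply, bumpSchwartz_apply]
  have h1 := bump.nonneg' (((n : ℝ) + 2)⁻¹ • x)
  have h2 : bump (((n : ℝ) + 2)⁻¹ • x) ≤ 1 := bump.le_one
  have h3 := bump.nonneg' (((n : ℝ) + 2) • x)
  have h4 : bump (((n : ℝ) + 2) • x) ≤ 1 := bump.le_one
  exact abs_le.2 ⟨by linarith, by linarith⟩

/-- Multiplying a first derivative by `‖x‖` makes it scale invariant, so one Schwartz bound for the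
bump serves all dilations. The second-order analogue uses `‖x‖²`. -/
theorem exists_norm_mul_partialDeriv_annulus_le :
    ∃ C, 0 ≤ C ∧ ∀ n i x, ‖x‖ * |partialDeriv i (annulus n) x| ≤ C := by
  choose C hC0 hC using fun i : Fin 3 => (partialDeriv i bumpSchwartz).decay 1 0
  have hb : ∀ (a : ℝ) (ha : 0 < a) (i : Fin 3) (x : R3),
      ‖x‖ * |partialDeriv i (dilate ha bumpSchwartz) x| ≤ C i := by
    intro a ha i x
    have := hC i (a • x)
    rw [norm_iteratedFDeriv_zero, norm_smul, Real.norm_of_nonneg ha.le, pow_one,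
      Real.norm_eq_abs] at this
    rw [partialDeriv_dilate, smul_apply, dilate_apply, smul_eq_mul, abs_mul, abs_of_pos ha]
    linarith
  refine ⟨2 * ∑ i, C i, mul_nonneg zero_le_two (Finset.sum_nonneg fun i _ => (hC0 i).le),
    fun n i x => ?_⟩
  have hCi : C i ≤ ∑ i, C i :=
    Finset.single_le_sum (fun j _ => (hC0 j).le) (Finset.mem_univ i)
  have h1 := hb ((n : ℝ) + 2)⁻¹ (by positivity) i x
  have h2 := hb ((n : ℝ) + 2) (by positivity) i x
  rw [annulus, partialDeriv_sub, sub_apply]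
  have h3 := mul_le_mul_of_nonneg_left (abs_sub (partialDeriv i
    (dilate (a := ((n : ℝ) + 2)⁻¹) (by positivity) bumpSchwartz) x) (partialDeriv i
    (dilate (a := ((n : ℝ) + 2)) (by positivity) bumpSchwartz) x)) (norm_nonneg x)
  linarith

theorem exists_norm_sq_mul_laplacian_annulus_le :
    ∃ C, 0 ≤ C ∧ ∀ n x, ‖x‖ ^ 2 * |Δ (annulus n) x| ≤ C := by
  obtain ⟨C, hC0, hC⟩ := (Δ bumpSchwartz).decay 2 0
  have hb : ∀ (a : ℝ) (ha : 0 < a) (x : R3),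
      ‖x‖ ^ 2 * |Δ (dilate ha bumpSchwartz) x| ≤ C := by
    intro a ha x
    have := hC (a • x)
    rw [norm_iteratedFDeriv_zero, norm_smul, Real.norm_of_nonneg ha.le, mul_pow,
      Real.norm_eq_abs] at this
    rw [laplacian_dilate, abs_mul, abs_of_pos (by positivity)]
    linarith
  refine ⟨2 * C, by positivity, fun n x => ?_⟩
  have h1 := hb ((n : ℝ) + 2)⁻¹ (by positivity) x
  have h2 := hb ((n : ℝ) + 2) (by positivity) x
  have e : Δ (annulus n) = Δ (dilate (a := ((n : ℝ) + 2)⁻¹) (by positivity) bumpSchwartz)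
      - Δ (dilate (a := ((n : ℝ) + 2)) (by positivity) bumpSchwartz) := by
    simp only [annulus, ← SchwartzMap.laplacianCLM_eq', map_sub]
  rw [e, sub_apply]
  have h3 := mul_le_mul_of_nonneg_left (abs_sub
    (Δ (dilate (a := ((n : ℝ) + 2)⁻¹) (by positivity) bumpSchwartz) x)
    (Δ (dilate (a := ((n : ℝ) + 2)) (by positivity) bumpSchwartz) x)) (sq_nonneg ‖x‖)
  linarith

theorem annulus_eventuallyEq_one {n : ℕ} {x : R3} (h1 : 2 < ((n : ℝ) + 2) * ‖x‖)
    (h2 : ‖x‖ < (n : ℝ) + 2) : annulus n =ᶠ[𝓝 x] fun _ => 1 := by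
  have e1 : ∀ᶠ y : R3 in 𝓝 x, 2 < ((n : ℝ) + 2) * ‖y‖ :=
    (continuous_const.mul continuous_norm).continuousAt.eventually (lt_mem_nhds h1)
  have e2 : ∀ᶠ y : R3 in 𝓝 x, ‖y‖ < (n : ℝ) + 2 :=
    continuous_norm.continuousAt.eventually (gt_mem_nhds h2)
  filter_upwards [e1, e2] with y hy1 hy2
  have hp : (0 : ℝ) < (n : ℝ) + 2 := by positivity
  rw [annulus_apply, bumpSchwartz_of_le, bumpSchwartz_of_ge, sub_zero]
  · rw [norm_smul, Real.norm_of_nonneg hp.le]; exact hy1.le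
  · rw [norm_smul, Real.norm_of_nonneg (by positivity), inv_mul_eq_div, div_le_one hp]
    exact hy2.le

theorem eventually_annulus_eventuallyEq_one {x : R3} (hx : x ≠ 0) :
    ∀ᶠ n in atTop, annulus n =ᶠ[𝓝 x] fun _ => 1 := by
  have hx' : 0 < ‖x‖ := norm_pos_iff.2 hx
  obtain ⟨N, hN⟩ := exists_nat_gt (max (2 / ‖x‖) ‖x‖)
  filter_upwards [eventually_ge_atTop N] with n hn
  have hn' : (N : ℝ) ≤ n := by exact_mod_cast hn
  refine annulus_eventuallyEq_one ?_ ?_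
  · rw [← div_lt_iff₀ hx']
    linarith [le_max_left (2 / ‖x‖) ‖x‖]
  · linarith [le_max_right (2 / ‖x‖) ‖x‖]

theorem annulus_eventuallyEq_zero (n : ℕ) : annulus n =ᶠ[𝓝 0] fun _ => 0 := by
  have e1 : ∀ᶠ y : R3 in 𝓝 0, ‖y‖ < ((n : ℝ) + 2)⁻¹ := by
    refine continuous_norm.continuousAt.eventually (gt_mem_nhds ?_)
    change ‖(0 : R3)‖ < _
    rw [norm_zero]; positivity
  filter_upwards [e1] with y hy
  have hp : (0 : ℝ) < (n : ℝ) + 2 := by positivity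
  have hy' : ((n : ℝ) + 2) * ‖y‖ ≤ 1 := by
    have := mul_le_mul_of_nonneg_left hy.le hp.le
    rwa [mul_inv_cancel₀ hp.ne'] at this
  have hy0 := norm_nonneg y
  rw [annulus_apply, bumpSchwartz_of_le, bumpSchwartz_of_le, sub_self]
  · rw [norm_smul, Real.norm_of_nonneg hp.le]; exact hy'
  · rw [norm_smul, Real.norm_of_nonneg (by positivity), inv_mul_eq_div, div_le_one hp]
    nlinarith

theorem hasCompactSupport_annulus (n : ℕ) : HasCompactSupport (annulus n) := by
  refine HasCompactSupport.intro (isCompact_closedBall (0 : R3) (2 * ((n : ℝ) + 2))) fun x hx => ?_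
  have hx' : 2 * ((n : ℝ) + 2) < ‖x‖ := by simpa using hx
  have hp : (0 : ℝ) ≤ (n : ℝ) := by positivity
  have hp2 : (0 : ℝ) < (n : ℝ) + 2 := by positivity
  rw [annulus_apply, bumpSchwartz_of_ge, bumpSchwartz_of_ge, sub_self]
  · rw [norm_smul, Real.norm_of_nonneg hp2.le]; nlinarith
  · rw [norm_smul, Real.norm_of_nonneg (by positivity), inv_mul_eq_div, le_div_iff₀ hp2]
    exact hx'.le

theorem isPuncturedTest_mul_annulus (f : 𝓢(R3, ℝ)) (n : ℕ) :
    IsPuncturedTest (𝕜 := ℝ) (schwartzMul f (annulus n)) where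
  smooth := (schwartzMul f (annulus n)).smooth ⊤
  compact := (hasCompactSupport_annulus n).mul_left (f := f)
  support := by
    rw [notMem_tsupport_iff_eventuallyEq]
    filter_upwards [annulus_eventuallyEq_zero n] with y hy
    simp [hy]

/-- A square-integrable weight dominating truncated Schwartz functions. -/
theorem memLp_inv_norm_mul_inv : MemLp (fun x : R3 => ‖x‖⁻¹ * (1 + ‖x‖ ^ 2)⁻¹) 2 volume := by
  have hm : Measurable fun x : R3 => ‖x‖⁻¹ * (1 + ‖x‖ ^ 2)⁻¹ := by fun_prop
  rw [memLp_two_iff_integrable_sq hm.aestronglyMeasurable]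
  refine (integrable_fun_norm_addHaar (volume : Measure R3)
    (f := fun r : ℝ => (r⁻¹ * (1 + r ^ 2)⁻¹) ^ 2)).2 ?_
  refine Integrable.mono' (g := fun r : ℝ => (1 + r ^ 2)⁻¹)
    (integrable_inv_one_add_sq.integrableOn) ?_ ?_
  · exact Measurable.aestronglyMeasurable (by fun_prop)
  · filter_upwards [ae_restrict_mem measurableSet_Ioi] with r (hr : 0 < r)
    -- In dimension three the Jacobian `r ^ 2` exactly cancels the singularity.
    have h1 : r ^ (Module.finrank ℝ R3 - 1) • (r⁻¹ * (1 + r ^ 2)⁻¹) ^ 2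
        = (1 + r ^ 2)⁻¹ * (1 + r ^ 2)⁻¹ := by
      simp only [finrank_euclideanSpace, Fintype.card_fin, smul_eq_mul]
      norm_num
      field_simp
    have h2 : (1 + r ^ 2)⁻¹ ≤ 1 := inv_le_one_of_one_le₀ (by nlinarith)
    rw [h1, Real.norm_of_nonneg (by positivity)]
    exact mul_le_of_le_one_left (by positivity) h2

theorem exists_abs_mul_le (f : 𝓢(R3, ℝ)) :
    ∃ C, 0 ≤ C ∧ ∀ x, |f x| * (1 + ‖x‖ ^ 2) ≤ C ∧ |f x| * (‖x‖ * (1 + ‖x‖ ^ 2)) ≤ C := by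
  choose C hC0 hC using fun k => f.decay k 0
  refine ⟨C 0 + C 1 + C 2 + C 3, by linarith [hC0 0, hC0 1, hC0 2, hC0 3], fun x => ?_⟩
  have h := fun k => hC k x
  simp only [norm_iteratedFDeriv_zero, Real.norm_eq_abs] at h
  have h0 := h 0
  have h1 := h 1
  have h2 := h 2
  have h3 := h 3
  rw [pow_zero, one_mul] at h0
  constructor <;> nlinarith [hC0 0, hC0 1, hC0 2, hC0 3]

/-- The mean value inequality gives the factor `‖x‖` near the origin, and Schwartz decay supplies
the quadratic weight at infinity. -/
theorem exists_abs_mul_le_norm {f : 𝓢(R3, ℝ)} (hf : f 0 = 0) :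
    ∃ C, 0 ≤ C ∧ ∀ x, |f x| * (1 + ‖x‖ ^ 2) ≤ C * ‖x‖ := by
  obtain ⟨C, hC0, hC⟩ := f.decay 1 0
  obtain ⟨K, hK0, hK⟩ := f.decay 0 1
  refine ⟨C + K, by positivity, fun x => ?_⟩
  have h1 := hC x
  have h2 : ‖f x - f 0‖ ≤ K * ‖x - 0‖ := by
    refine Convex.norm_image_sub_le_of_norm_fderiv_le (𝕜 := ℝ) (s := Set.univ)
      (fun y _ => f.differentiableAt) (fun y _ => ?_) convex_univ trivial trivial
    have := hK y
    rwa [pow_zero, one_mul, norm_iteratedFDeriv_one] at this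
  rw [norm_iteratedFDeriv_zero, pow_one, Real.norm_eq_abs] at h1
  rw [hf, sub_zero, sub_zero, Real.norm_eq_abs] at h2
  nlinarith [mul_le_mul_of_nonneg_right h1 (norm_nonneg x)]

/-- In the Leibniz expansion the cutoff gradient is `O(‖x‖⁻¹)` and its Laplacian `O(‖x‖⁻²)`. As `f =
O(‖x‖)`, every term is `O(‖x‖⁻¹)` at the origin, which is square integrable in dimension three; a
bound of order `‖x‖⁻²` would not be. -/
theorem exists_abs_helmholtz_mul_annulus_le (μ : ℝ) {f : 𝓢(R3, ℝ)} (hf : f 0 = 0) :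
    ∃ C, ∀ n x, x ≠ 0 →
      |helmholtz μ (schwartzMul f (annulus n)) x| ≤ C * (‖x‖⁻¹ * (1 + ‖x‖ ^ 2)⁻¹) := by
  obtain ⟨A, hA0, hA⟩ := exists_norm_mul_partialDeriv_annulus_le
  obtain ⟨B, hB0, hB⟩ := exists_norm_sq_mul_laplacian_annulus_le
  obtain ⟨C, hC0, hC⟩ := exists_abs_mul_le (helmholtz μ f)
  choose D hD0 hD using fun i => exists_abs_mul_le (partialDeriv i f)
  obtain ⟨E, hE0, hE⟩ := exists_abs_mul_le_norm hf
  refine ⟨C + ∑ i, D i * A + 1 / 2 * (E * B), fun n x hx => ?_⟩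
  have hr : 0 < ‖x‖ := norm_pos_iff.2 hx
  set r := ‖x‖ with hrdef
  set s := 1 + r ^ 2 with hs
  have hs0 : 0 < s := by positivity
  rw [← mul_inv, ← div_eq_mul_inv, le_div_iff₀ (by positivity), helmholtz_mul]
  have t1 : |annulus n x * helmholtz μ f x| * (r * s) ≤ C := by
    rw [abs_mul]
    calc |annulus n x| * |helmholtz μ f x| * (r * s)
        ≤ 1 * |helmholtz μ f x| * (r * s) := by
          gcongr; exact abs_annulus_le n x
      _ ≤ C := by rw [one_mul]; exact (hC x).2
  have t2 : |∑ i, partialDeriv i f x * partialDeriv i (annulus n) x| * (r * s)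
      ≤ ∑ i, D i * A := by
    refine (mul_le_mul_of_nonneg_right (Finset.abs_sum_le_sum_abs _ _) (by positivity)).trans ?_
    rw [Finset.sum_mul]
    refine Finset.sum_le_sum fun i _ => ?_
    rw [abs_mul]
    calc |partialDeriv i f x| * |partialDeriv i (annulus n) x| * (r * s)
        = (|partialDeriv i f x| * s) * (r * |partialDeriv i (annulus n) x|) := by ring
      _ ≤ D i * A := mul_le_mul (hD i x).1 (hA n i x) (by positivity) (hD0 i)
  have t3 : |1 / 2 * (f x * Δ (annulus n) x)| * (r * s) ≤ 1 / 2 * (E * B) := by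
    rw [abs_mul, abs_of_pos (by norm_num : (0 : ℝ) < 1 / 2), abs_mul]
    calc 1 / 2 * (|f x| * |Δ (annulus n) x|) * (r * s)
        = 1 / 2 * ((|f x| * s) * |Δ (annulus n) x| * r) := by ring
      _ ≤ 1 / 2 * ((E * r) * |Δ (annulus n) x| * r) := by
          have hfs : |f x| * s ≤ E * r := hE x
          gcongr
      _ = 1 / 2 * (E * (r ^ 2 * |Δ (annulus n) x|)) := by ring
      _ ≤ 1 / 2 * (E * B) := by gcongr; exact hB n x
  have h1 := abs_sub (annulus n x * helmholtz μ f x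
    - ∑ i, partialDeriv i f x * partialDeriv i (annulus n) x) (1 / 2 * (f x * Δ (annulus n) x))
  have h2 := abs_sub (annulus n x * helmholtz μ f x)
    (∑ i, partialDeriv i f x * partialDeriv i (annulus n) x)
  have h3 := mul_le_mul_of_nonneg_right (h1.trans (add_le_add_left h2 _))
    (by positivity : 0 ≤ r * s)
  refine h3.trans ?_
  rw [add_mul, add_mul]
  linarith

theorem tendsto_helmholtz_mul_annulus (μ : ℝ) (f : 𝓢(R3, ℝ)) {x : R3} (hx : x ≠ 0) :
    Tendsto (fun n => helmholtz μ (schwartzMul f (annulus n)) x) atTop (𝓝 (helmholtz μ f x)) := by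
  refine tendsto_const_nhds.congr' ?_
  filter_upwards [eventually_annulus_eventuallyEq_one hx] with n hn
  rw [helmholtz_mul, laplacian_congr_of_eventuallyEq_const hn, hn.eq_of_nhds]
  simp [partialDeriv_eq_zero_of_eventuallyEq_const _ hn]

/-- An `L²` function orthogonal to `(μ - ½ Δ) C_c^∞(ℝ³ ∖ {0})` is orthogonal to `(μ - ½ Δ) f` for all
Schwartz functions `f` vanishing at the origin. -/
theorem integral_mul_helmholtz_eq_zero {w : R3 → ℝ} (hw : MemLp w 2 volume) {μ : ℝ}
    (h : ∀ f : 𝓢(R3, ℝ), IsPuncturedTest (𝕜 := ℝ) f → ∫ x, w x * helmholtz μ f x = 0)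
    {f : 𝓢(R3, ℝ)} (hf : f 0 = 0) : ∫ x, w x * helmholtz μ f x = 0 := by
  obtain ⟨C, hC⟩ := exists_abs_helmholtz_mul_annulus_le μ hf
  have hne : ∀ᵐ x : R3 ∂volume, x ≠ 0 := by
    rw [ae_iff]; simp
  have key := tendsto_integral_of_dominated_convergence (μ := (volume : Measure R3))
    (F := fun n x => w x * helmholtz μ (schwartzMul f (annulus n)) x)
    (f := fun x => w x * helmholtz μ f x)
    (bound := fun x => ‖w x‖ * (C * (‖x‖⁻¹ * (1 + ‖x‖ ^ 2)⁻¹)))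
    (fun n => hw.aestronglyMeasurable.mul
      (helmholtz μ (schwartzMul f (annulus n))).continuous.aestronglyMeasurable)
    (hw.norm.integrable_mul (memLp_inv_norm_mul_inv.const_mul C)) (fun n => ?_) ?_
  · refine tendsto_nhds_unique key ?_
    simp only [h _ (isPuncturedTest_mul_annulus f _)]
    exact tendsto_const_nhds
  · filter_upwards [hne] with x hx
    rw [norm_mul]
    exact mul_le_mul_of_nonneg_left (hC n x hx) (norm_nonneg _)
  · filter_upwards [hne] with x hx
    exact (tendsto_helmholtz_mul_annulus μ f hx).const_mul (w x)

end Cutoff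

end ZeroRange

namespace ZeroRange

/-! ### Solving the Helmholtz equation and identifying the `L²` kernel. -/

section Kernel

open scoped SchwartzMap LineDeriv Laplacian FourierTransform

theorem hasTemperateGrowth_inv_add_norm_sq {μ b : ℝ} (hμ : 0 < μ) (hb : 0 ≤ b) :
    Function.HasTemperateGrowth fun x : R3 => (μ + b * ‖x‖ ^ 2)⁻¹ := by
  have h1 := (Function.hasTemperateGrowth_one_add_norm_sq_rpow R3 (-1)).comp
    (√(b / μ) • ContinuousLinearMap.id ℝ R3).hasTemperateGrowth
  have h2 := (Function.HasTemperateGrowth.const (E := R3) μ⁻¹).mul h1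
  convert! h2 using 1
  ext x
  simp only [Pi.mul_apply, Function.comp_apply, smul_apply, ContinuousLinearMap.id_apply, norm_smul,
    Real.norm_of_nonneg (Real.sqrt_nonneg _), mul_pow, Real.sq_sqrt (div_nonneg hb hμ.le),
    Real.rpow_neg_one]
  rw [← mul_inv]
  congr 1
  field_simp

/-- `μ - ½ Δ` is onto on Schwartz functions. -/
theorem exists_helmholtz_eq {μ : ℝ} (hμ : 0 < μ) (g : 𝓢(R3, ℝ)) :
    ∃ f : 𝓢(R3, ℝ), helmholtz μ f = g := by
  set gc : 𝓢(R3, ℂ) := g.postcompCLM Complex.ofRealCLM with hgc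
  -- In the `2π` normalisation of the Fourier transform, `-½ Δ` has symbol `2 π² ‖ξ‖²`; this is the
  -- reciprocal of the symbol of `μ - ½ Δ`.
  set m : R3 → ℝ := fun x => (μ + (2 * Real.pi ^ 2) * ‖x‖ ^ 2)⁻¹ with hm
  have hmt : m.HasTemperateGrowth := hasTemperateGrowth_inv_add_norm_sq hμ (by positivity)
  have hnt : (fun x : R3 => ‖x‖ ^ 2).HasTemperateGrowth := Function.hasTemperateGrowth_norm_sq R3
  set h : 𝓢(R3, ℂ) := SchwartzMap.smulLeftCLM ℂ m (𝓕 gc) with hh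
  set F : 𝓢(R3, ℂ) := 𝓕⁻ h with hF
  have hΔ : Δ F = -(2 * Real.pi) ^ 2 • 𝓕⁻ (SchwartzMap.smulLeftCLM ℂ (fun x : R3 => ‖x‖ ^ 2) h) := by
    rw [SchwartzMap.laplacian_eq_fourierMultiplierCLM, SchwartzMap.fourierMultiplierCLM_apply, hF,
      FourierTransform.fourier_fourierInv_eq]
  have hfull : μ • F - (1 / 2 : ℝ) • Δ F = gc := by
    have e : μ • h + (2 * Real.pi ^ 2) • SchwartzMap.smulLeftCLM ℂ (fun x : R3 => ‖x‖ ^ 2) h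
        = 𝓕 gc := by
      ext x
      have hx : μ + (2 * Real.pi ^ 2) * ‖x‖ ^ 2 ≠ 0 := by positivity
      have hmx : (μ + (2 * Real.pi ^ 2) * ‖x‖ ^ 2) * m x = 1 := mul_inv_cancel₀ hx
      simp only [add_apply, smul_apply, SchwartzMap.smulLeftCLM_apply_apply hnt,
        hh, SchwartzMap.smulLeftCLM_apply_apply hmt, smul_smul, ← add_smul]
      rw [show μ * m x + 2 * Real.pi ^ 2 * (‖x‖ ^ 2 * m x) = 1 by rw [← hmx]; ring, one_smul]
    have hinv : 𝓕⁻ (𝓕 gc) = gc := FourierTransform.fourierInv_fourier_eq gc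
    rw [← hinv, ← e,
      FourierTransform.fourierInv_add, FourierTransform.fourierInv_smul,
      FourierTransform.fourierInv_smul, hΔ, smul_smul, sub_eq_add_neg, ← neg_smul]
    congr 2
    ring
  -- The operator has real coefficients and `g` is real, so the real part of the complex solution is
  -- again a solution.
  refine ⟨F.postcompCLM Complex.reCLM, ?_⟩
  ext x
  have h1 : Δ (F.postcompCLM Complex.reCLM) x = (Δ F x).re := by
    rw [SchwartzMap.laplacian_apply, SchwartzMap.laplacian_apply]
    exact (F.contDiffAt 2).laplacian_CLM_comp_left (l := Complex.reCLM)
  have h2 := congrArg (fun k : 𝓢(R3, ℂ) => (k x).re) hfull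
  rw [helmholtz_apply, h1]
  have h3 : gc x = (g x : ℂ) := rfl
  simpa [h3] using h2

theorem hasFDerivAt_norm_sq (x : R3) :
    HasFDerivAt (fun y : R3 => ‖y‖ ^ 2) (2 • innerSL ℝ x) x :=
  (hasStrictFDerivAt_norm_sq x).hasFDerivAt

/-- The Laplacian of a function of `‖x‖²` in dimension three. -/
theorem laplacian_of_eventuallyEq_radial {f : 𝓢(R3, ℝ)} {x : R3} {G G₁ : ℝ → ℝ} {G₂ : ℝ}
    (hf : f =ᶠ[𝓝 x] fun y => G (‖y‖ ^ 2))
    (hG : ∀ᶠ s in 𝓝 (‖x‖ ^ 2), HasDerivAt G (G₁ s) s) (hG₁ : HasDerivAt G₁ G₂ (‖x‖ ^ 2)) :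
    Δ f x = 6 * G₁ (‖x‖ ^ 2) + 4 * ‖x‖ ^ 2 * G₂ := by
  have hc : ContinuousAt (fun y : R3 => ‖y‖ ^ 2) x := by fun_prop
  have h1 : ∀ i : Fin 3, partialDeriv i f =ᶠ[𝓝 x] fun y => 2 * y i * G₁ (‖y‖ ^ 2) := by
    intro i
    filter_upwards [hf.eventuallyEq_nhds, hc.eventually hG] with y hy hGy
    have := hGy.comp_hasFDerivAt y (hasFDerivAt_norm_sq y)
    rw [SchwartzMap.lineDerivOp_apply_eq_fderiv, hy.fderiv_eq]
    erw [this.fderiv]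
    simp [PiLp.inner_apply]
    ring
  have h2 : ∀ i : Fin 3, partialDeriv i (partialDeriv i f) x
      = 2 * G₁ (‖x‖ ^ 2) + 4 * (x i) ^ 2 * G₂ := by
    intro i
    rw [SchwartzMap.lineDerivOp_apply_eq_fderiv, (h1 i).fderiv_eq]
    have ha : HasFDerivAt (fun y : R3 => 2 * y i) ((2 : ℝ) • (EuclideanSpace.proj i : R3 →L[ℝ] ℝ)) x :=
      ((EuclideanSpace.proj i : R3 →L[ℝ] ℝ).hasFDerivAt).const_mul 2
    have hb := hG₁.comp_hasFDerivAt x (hasFDerivAt_norm_sq x)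
    have hab := ha.mul hb
    erw [hab.fderiv]
    simp [PiLp.inner_apply]
    ring
  rw [laplacian_eq_sum_partialDeriv, sum_apply, Finset.sum_congr rfl fun i _ => h2 i,
    EuclideanSpace.norm_sq_eq]
  simp only [Fin.sum_univ_three, Real.norm_eq_abs, sq_abs]
  ring

theorem hasDerivAt_yukawa (γ : ℝ) {s : ℝ} (hs : 0 < s) :
    HasDerivAt (fun s => Real.exp (-γ * √s) / √s)
      (-(Real.exp (-γ * √s) * (γ * √s + 1)) / (2 * √s ^ 3)) s := by
  have hr : √s ≠ 0 := (Real.sqrt_pos.2 hs).ne'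
  have h1 := Real.hasDerivAt_sqrt hs.ne'
  have h2 := ((h1.const_mul (-γ)).exp).div h1 hr
  convert! h2 using 1
  field_simp
  ring

theorem hasDerivAt_deriv_yukawa (γ : ℝ) {s : ℝ} (hs : 0 < s) :
    HasDerivAt (fun s => -(Real.exp (-γ * √s) * (γ * √s + 1)) / (2 * √s ^ 3))
      (Real.exp (-γ * √s) * (γ ^ 2 * √s ^ 2 + 3 * γ * √s + 3) / (4 * √s ^ 5)) s := by
  have hr : √s ≠ 0 := (Real.sqrt_pos.2 hs).ne'
  have h1 := Real.hasDerivAt_sqrt hs.ne'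
  have h2 := (((h1.const_mul (-γ)).exp.mul ((h1.const_mul γ).add_const 1)).neg).div
    ((h1.pow 3).const_mul 2) (mul_ne_zero two_ne_zero (pow_ne_zero 3 hr))
  convert! h2 using 1
  simp only [Pi.neg_apply, Pi.mul_apply, Pi.pow_apply]
  field_simp
  ring

/-- With `r = ‖x‖`, the radial formula gives `exp (-γ r) / r³` times `-3 (γ r + 1) + (γ² r² + 3 γ r
+ 3) = γ² r²`. -/
theorem laplacian_of_eventuallyEq_psi {f : 𝓢(R3, ℝ)} {γ : ℝ} {x : R3} (hx : x ≠ 0)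
    (hf : f =ᶠ[𝓝 x] psi γ) : Δ f x = γ ^ 2 * psi γ x := by
  have hr : 0 < ‖x‖ := norm_pos_iff.2 hx
  set c := Real.sqrt γ / Real.sqrt (2 * Real.pi) with hc
  have hs : 0 < ‖x‖ ^ 2 := by positivity
  have h := laplacian_of_eventuallyEq_radial (f := f) (x := x)
    (G := fun s => c * (Real.exp (-γ * √s) / √s))
    (G₁ := fun s => c * (-(Real.exp (-γ * √s) * (γ * √s + 1)) / (2 * √s ^ 3)))
    (hf.trans (Eventually.of_forall fun y => by
      simp only [psi, Real.sqrt_sq (norm_nonneg y), hc]))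
    (by
      filter_upwards [lt_mem_nhds hs] with s hs
      exact (hasDerivAt_yukawa γ hs).const_mul c)
    ((hasDerivAt_deriv_yukawa γ hs).const_mul c)
  rw [h, psi, ← hc]
  simp only [Real.sqrt_sq hr.le]
  field_simp
  ring

theorem contDiffAt_psi (γ : ℝ) {x : R3} (hx : x ≠ 0) : ContDiffAt ℝ ∞ (psi γ) x := by
  unfold psi
  have h := contDiffAt_norm ℝ hx (n := ∞)
  exact contDiffAt_const.mul (((contDiffAt_const.mul h).exp).div h (norm_ne_zero_iff.2 hx))

theorem contDiff_psi_mul_annulus (γ : ℝ) (n : ℕ) :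
    ContDiff ℝ ∞ fun x => psi γ x * annulus n x := by
  rw [contDiff_iff_contDiffAt]
  intro x
  by_cases hx : x = 0
  · subst hx
    refine (contDiffAt_const (c := (0 : ℝ))).congr_of_eventuallyEq ?_
    filter_upwards [annulus_eventuallyEq_zero n] with y hy
    rw [hy, mul_zero]
  · exact (contDiffAt_psi γ hx).mul ((annulus n).smooth ⊤).contDiffAt

theorem exists_annulus_eventuallyEq_one {K : Set R3} (hK : IsCompact K) (h0 : (0 : R3) ∉ K) :
    ∃ n, ∀ x ∈ K, annulus n =ᶠ[𝓝 x] fun _ => 1 := by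
  obtain ⟨δ, hδ, hδK⟩ := Metric.isOpen_iff.1 hK.isClosed.isOpen_compl 0 h0
  obtain ⟨R, hR⟩ := hK.isBounded.exists_norm_le
  obtain ⟨n, hn⟩ := exists_nat_gt (max (2 / δ) R)
  refine ⟨n, fun x hx => annulus_eventuallyEq_one ?_ ?_⟩
  · have h1 : δ ≤ ‖x‖ := by
      by_contra hlt
      exact hδK (by simpa using hlt) hx
    have h2 : 2 / δ < (n : ℝ) + 2 := by linarith [le_max_left (2 / δ) R]
    rw [div_lt_iff₀ hδ] at h2
    nlinarith
  · linarith [hR x hx, le_max_right (2 / δ) R]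

theorem laplacian_eq_zero_of_notMem_tsupport {F : Type*} [NormedAddCommGroup F] [NormedSpace ℝ F]
    {f : R3 → F} {x : R3} (hx : x ∉ tsupport f) : Δ f x = 0 := by
  rw [notMem_tsupport_iff_eventuallyEq] at hx
  rw [(InnerProductSpace.laplacian_congr_nhds hx).eq_of_nhds]
  exact congrFun (InnerProductSpace.laplacian_const (c := (0 : F))) x

/-- `ψ_γ` is orthogonal to `(γ² / 2 - ½ Δ) C_c^∞(ℝ³ ∖ {0})`. -/
theorem integral_psi_smul_eq_zero {𝕜 : Type*} [RCLike 𝕜] (γ : ℝ) {f : R3 → 𝕜}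
    (hf : IsPuncturedTest f) :
    ∫ x, psi γ x • ((γ ^ 2 / 2 : ℝ) • f x - halfLaplacian f x) = 0 := by
  obtain ⟨n, hn⟩ := exists_annulus_eventuallyEq_one hf.compact.isCompact hf.support
  -- A Schwartz function equal to `ψ_γ` near the support of `f`, so that the Laplacian can be moved
  -- across by parts without boundary terms at `0`.
  set g : 𝓢(R3, ℝ) := ((hasCompactSupport_annulus n).mul_left (f := psi γ)).toSchwartzMap
    (contDiff_psi_mul_annulus γ n) with hg
  have hga : ∀ x, g x = psi γ x * annulus n x := fun x => rfl
  set fS : 𝓢(R3, 𝕜) := hf.compact.toSchwartzMap hf.smooth with hfS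
  have hfa : ∀ x, fS x = f x := fun x => rfl
  have hΔf : ∀ x, Δ fS x = Δ f x := fun x => SchwartzMap.laplacian_apply fS x
  have e1 : ∀ x, psi γ x • ((γ ^ 2 / 2 : ℝ) • f x - halfLaplacian f x)
      = (γ ^ 2 / 2) • g x • fS x - (1 / 2 : ℝ) • g x • Δ fS x := by
    intro x
    rw [halfLaplacian, hΔf, hfa]
    by_cases hx : x ∈ tsupport f
    · rw [hga, (hn x hx).eq_of_nhds, mul_one]
      module
    · rw [image_eq_zero_of_notMem_tsupport hx, laplacian_eq_zero_of_notMem_tsupport hx]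
      simp
  have e2 : ∀ x, Δ g x • fS x = (γ ^ 2) • g x • fS x := by
    intro x
    by_cases hx : x ∈ tsupport f
    · have hx0 : x ≠ 0 := fun h => hf.support (h ▸ hx)
      have : g =ᶠ[𝓝 x] psi γ := by
        filter_upwards [hn x hx] with y hy
        rw [hga, hy, mul_one]
      rw [laplacian_of_eventuallyEq_psi hx0 this, this.eq_of_nhds, mul_smul]
    · rw [hfa, image_eq_zero_of_notMem_tsupport hx]
      simp
  have i1 : Integrable (fun x => g x • fS x) volume :=
    (SchwartzMap.pairing (ContinuousLinearMap.lsmul ℝ ℝ) g fS).integrable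
  have i2 : Integrable (fun x => g x • Δ fS x) volume :=
    (SchwartzMap.pairing (ContinuousLinearMap.lsmul ℝ ℝ) g (Δ fS)).integrable
  simp only [e1]
  have j1 : Integrable (fun x => (γ ^ 2 / 2 : ℝ) • g x • fS x) volume := i1.smul (γ ^ 2 / 2)
  have j2 : Integrable (fun x => (1 / 2 : ℝ) • g x • Δ fS x) volume := i2.smul (1 / 2 : ℝ)
  rw [integral_sub j1 j2, integral_smul, integral_smul,
    SchwartzMap.integral_smul_laplacian_right_eq_left]
  simp only [e2]
  rw [integral_smul, smul_smul, ← sub_smul]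
  ring_nf
  simp

theorem integrable_mul_schwartz {w : R3 → ℝ} (hw : MemLp w 2 volume) (f : 𝓢(R3, ℝ)) :
    Integrable (fun x => w x * f x) volume :=
  hw.integrable_mul (f.memLp 2 volume)

theorem memLp_psi_real {γ : ℝ} (hγ : 0 < γ) : MemLp (psi γ) 2 (volume : Measure R3) :=
  memLp_psi ℝ hγ

theorem ae_eq_zero_of_integral_mul_schwartz {w : R3 → ℝ} (hw : MemLp w 2 volume)
    (h : ∀ f : 𝓢(R3, ℝ), ∫ x, w x * f x = 0) : w =ᵐ[volume] 0 := by
  refine ae_eq_zero_of_integral_contDiff_smul_eq_zero (hw.locallyIntegrable (by norm_num))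
    fun g hg hgc => ?_
  rw [← h (hgc.toSchwartzMap hg)]
  exact integral_congr_ae (Eventually.of_forall fun x => mul_comm _ _)

theorem psi_pos {γ : ℝ} (hγ : 0 < γ) {x : R3} (hx : x ≠ 0) : 0 < psi γ x := by
  have := norm_pos_iff.2 hx
  have := Real.pi_pos
  unfold psi
  positivity

theorem helmholtz_sub_smul (μ c : ℝ) (f g : 𝓢(R3, ℝ)) :
    helmholtz μ (f - c • g) = helmholtz μ f - c • helmholtz μ g := by
  simp only [helmholtz, ← SchwartzMap.laplacianCLM_eq', map_sub, map_smul]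
  module

/-- The pairing with `(μ - ½ Δ) f` only depends on `f 0`. -/
theorem integral_mul_helmholtz {w : R3 → ℝ} (hw : MemLp w 2 volume) {μ : ℝ}
    (h : ∀ f : 𝓢(R3, ℝ), IsPuncturedTest (𝕜 := ℝ) f → ∫ x, w x * helmholtz μ f x = 0)
    (f : 𝓢(R3, ℝ)) :
    ∫ x, w x * helmholtz μ f x = f 0 * ∫ x, w x * helmholtz μ bumpSchwartz x := by
  have hb : bumpSchwartz 0 = 1 := bumpSchwartz_of_le (by simp)
  have h1 := integral_mul_helmholtz_eq_zero hw h (f := f - f 0 • bumpSchwartz) (by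
    rw [sub_apply, smul_apply, hb]; simp)
  have e : ∀ x, w x * helmholtz μ (f - f 0 • bumpSchwartz) x
      = w x * helmholtz μ f x - f 0 * (w x * helmholtz μ bumpSchwartz x) := by
    intro x
    rw [helmholtz_sub_smul, sub_apply, smul_apply, smul_eq_mul]
    ring
  simp only [e] at h1
  rw [integral_sub (integrable_mul_schwartz hw _) ((integrable_mul_schwartz hw _).const_mul _),
    integral_const_mul] at h1
  linarith

/-- Every `L²` function orthogonal to `(γ² / 2 - ½ Δ) C_c^∞(ℝ³ ∖ {0})` is a multiple of `ψ_γ`. -/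
theorem exists_ae_eq_mul_psi {γ : ℝ} (hγ : 0 < γ) {w : R3 → ℝ} (hw : MemLp w 2 volume)
    (h : ∀ f : 𝓢(R3, ℝ), IsPuncturedTest (𝕜 := ℝ) f →
      ∫ x, w x * helmholtz (γ ^ 2 / 2) f x = 0) :
    ∃ c : ℝ, w =ᵐ[volume] fun x => c * psi γ x := by
  have hμ : 0 < γ ^ 2 / 2 := by positivity
  have hψ : ∀ f : 𝓢(R3, ℝ), IsPuncturedTest (𝕜 := ℝ) f →
      ∫ x, psi γ x * helmholtz (γ ^ 2 / 2) f x = 0 := by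
    intro f hf
    rw [← integral_psi_smul_eq_zero γ hf]
    refine integral_congr_ae (Eventually.of_forall fun x => ?_)
    simp only [helmholtz_apply, halfLaplacian, SchwartzMap.laplacian_apply, smul_eq_mul]
  have hψL := memLp_psi_real hγ
  set a := ∫ x, psi γ x * helmholtz (γ ^ 2 / 2) bumpSchwartz x with ha
  set b := ∫ x, w x * helmholtz (γ ^ 2 / 2) bumpSchwartz x with hb
  -- If `a = 0`, then `ψ_γ` is orthogonal to the range of `μ - ½ Δ`, that is to all Schwartz
  -- functions, contradicting its positivity.
  have ha0 : a ≠ 0 := by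
    intro ha0
    have hz := ae_eq_zero_of_integral_mul_schwartz hψL fun g => by
      obtain ⟨f, rfl⟩ := exists_helmholtz_eq hμ g
      rw [integral_mul_helmholtz hψL hψ, ← ha, ha0, mul_zero]
    have hne : ∀ᵐ x : R3 ∂volume, x ≠ 0 := by
      rw [ae_iff]; simp
    obtain ⟨x, hx1, hx2⟩ := (hz.and hne).exists
    exact (psi_pos hγ hx2).ne' hx1
  -- This ratio cancels the point evaluation at `0`, leaving a function orthogonal to all Schwartz
  -- functions.
  refine ⟨b / a, ?_⟩
  have hd : MemLp (fun x => w x - b / a * psi γ x) 2 volume := hw.sub (hψL.const_mul _)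
  have hz := ae_eq_zero_of_integral_mul_schwartz hd fun g => by
    obtain ⟨f, rfl⟩ := exists_helmholtz_eq hμ g
    simp only [sub_mul, mul_assoc]
    rw [integral_sub (integrable_mul_schwartz hw _)
      ((integrable_mul_schwartz hψL _).const_mul _), integral_const_mul,
      integral_mul_helmholtz hψL hψ, integral_mul_helmholtz hw h, ← ha, ← hb]
    field_simp
    ring
  filter_upwards [hz] with x hx
  exact sub_eq_zero.1 hx

end Kernel

end ZeroRange

namespace ZeroRange

/-! ### The minimal operator satisfies the abstract hypotheses. -/

section Minimal

open scoped SchwartzMap LineDeriv Laplacian ComplexConjugate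

variable {𝕜 : Type*} [RCLike 𝕜]

/-- A punctured test function as a Schwartz function. -/
noncomputable def IsPuncturedTest.toSchwartz {f : R3 → 𝕜} (hf : IsPuncturedTest f) : 𝓢(R3, 𝕜) :=
  hf.compact.toSchwartzMap hf.smooth

theorem IsPuncturedTest.toSchwartz_apply {f : R3 → 𝕜} (hf : IsPuncturedTest f) (x : R3) :
    hf.toSchwartz x = f x := rfl

theorem IsPuncturedTest.halfLaplacian_eq {f : R3 → 𝕜} (hf : IsPuncturedTest f) (x : R3) :
    halfLaplacian f x = (1 / 2 : ℝ) • Δ hf.toSchwartz x := by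
  rw [halfLaplacian, SchwartzMap.laplacian_apply]
  rfl

theorem IsPuncturedTest.memLp {f : R3 → 𝕜} (hf : IsPuncturedTest f) : MemLp f 2 volume :=
  hf.toSchwartz.memLp 2 volume

theorem IsPuncturedTest.memLp_halfLaplacian {f : R3 → 𝕜} (hf : IsPuncturedTest f) :
    MemLp (halfLaplacian f) 2 volume := by
  have h := ((Δ hf.toSchwartz).memLp 2 volume).const_smul (1 / 2 : ℝ)
  convert! h using 1
  exact funext hf.halfLaplacian_eq

theorem IsPuncturedTest.exists_mem_graph {f : R3 → 𝕜} (hf : IsPuncturedTest f) :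
    ∃ p ∈ (minimalOperator 𝕜).graph, p.1 =ᵐ[volume] f ∧ p.2 =ᵐ[volume] halfLaplacian f := by
  rw [graph_minimalOperator]
  exact ⟨(hf.memLp.toLp f, hf.memLp_halfLaplacian.toLp _),
    ⟨f, hf, hf.memLp.coeFn_toLp, hf.memLp_halfLaplacian.coeFn_toLp⟩,
    hf.memLp.coeFn_toLp, hf.memLp_halfLaplacian.coeFn_toLp⟩

theorem IsPuncturedTest.ofReal {f : R3 → ℝ} (hf : IsPuncturedTest (𝕜 := ℝ) f) :
    IsPuncturedTest fun x => (f x : 𝕜) where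
  smooth := (RCLike.ofRealCLM (K := 𝕜)).contDiff.comp hf.smooth
  compact := hf.compact.comp_left (g := fun r : ℝ => (r : 𝕜)) RCLike.ofReal_zero
  support := fun h => hf.support
    (tsupport_comp_subset (g := fun r : ℝ => (r : 𝕜)) RCLike.ofReal_zero f h)

theorem IsPuncturedTest.halfLaplacian_ofReal {f : R3 → ℝ} (hf : IsPuncturedTest (𝕜 := ℝ) f)
    (x : R3) : halfLaplacian (fun x => (f x : 𝕜)) x = ((halfLaplacian f x : ℝ) : 𝕜) := by
  have hf' : ContDiffAt ℝ 2 f x := (hf.smooth.of_le (WithTop.coe_le_coe.2 le_top)).contDiffAt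
  have h : Δ (fun x => (f x : 𝕜)) x = ((Δ f x : ℝ) : 𝕜) :=
    hf'.laplacian_CLM_comp_left (l := RCLike.ofRealCLM (K := 𝕜))
  rw [halfLaplacian, h, halfLaplacian, RCLike.real_smul_eq_coe_mul, smul_eq_mul, RCLike.ofReal_mul]

theorem inner_eq_integral {u v : L2 𝕜} {f g : R3 → 𝕜} (hu : u =ᵐ[volume] f)
    (hv : v =ᵐ[volume] g) : ⟪u, v⟫_𝕜 = ∫ x, conj (f x) * g x := by
  rw [L2.inner_def]
  refine integral_congr_ae ?_
  filter_upwards [hu, hv] with x hx hy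
  rw [hx, hy, RCLike.inner_apply, mul_comm]

/-- The sesquilinear pairing of scalars as a real bilinear map. -/
noncomputable def conjMul (𝕜 : Type*) [RCLike 𝕜] : 𝕜 →L[ℝ] 𝕜 →L[ℝ] 𝕜 :=
  (ContinuousLinearMap.mul ℝ 𝕜).comp (RCLike.conjCLE (K := 𝕜)).toContinuousLinearMap

theorem conjMul_apply (a b : 𝕜) : conjMul 𝕜 a b = conj a * b := rfl

theorem inner_graph_eq {p q : L2 𝕜 × L2 𝕜} {f g : R3 → 𝕜} (hg : IsPuncturedTest g)
    (hf : IsPuncturedTest f) (hp : p.1 =ᵐ[volume] f) (hq : q.2 =ᵐ[volume] halfLaplacian g) :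
    ⟪p.1, q.2⟫_𝕜 = (1 / 2 : ℝ) • ∫ x, conjMul 𝕜 (hf.toSchwartz x) (Δ hg.toSchwartz x) := by
  rw [inner_eq_integral hp hq, ← integral_smul]
  refine integral_congr_ae (Eventually.of_forall fun x => ?_)
  simp only [hg.halfLaplacian_eq, conjMul_apply, mul_smul_comm, hf.toSchwartz_apply]

theorem minimalOperator_symm : ∀ p ∈ (minimalOperator 𝕜).graph,
    ∀ q ∈ (minimalOperator 𝕜).graph, ⟪p.2, q.1⟫_𝕜 = ⟪p.1, q.2⟫_𝕜 := by
  rw [graph_minimalOperator]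
  rintro p ⟨f, hf, hp1, hp2⟩ q ⟨g, hg, hq1, hq2⟩
  rw [inner_graph_eq hg hf hp1 hq2, SchwartzMap.integral_bilinear_laplacian_right_eq_left,
    inner_eq_integral hp2 hq1, ← integral_smul]
  refine integral_congr_ae (Eventually.of_forall fun x => ?_)
  simp only [hf.halfLaplacian_eq, conjMul_apply, hg.toSchwartz_apply, RCLike.conj_smul,
    smul_mul_assoc]

/-- Integration by parts turns the form into minus half the sum of the squared `L²` norms of the
partial derivatives. -/
theorem minimalOperator_nonpos : ∀ p ∈ (minimalOperator 𝕜).graph,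
    RCLike.re ⟪p.2, p.1⟫_𝕜 ≤ 0 := by
  intro p hp
  rw [minimalOperator_symm p hp p hp]
  rw [graph_minimalOperator] at hp
  obtain ⟨f, hf, hp1, hp2⟩ := hp
  set F := hf.toSchwartz with hF
  set b := EuclideanSpace.basisFun (Fin 3) ℝ with hb
  have hi : ∀ i, Integrable (fun x => conjMul 𝕜 (F x) ((∂_{b i} (∂_{b i} F)) x)) volume :=
    fun i => (SchwartzMap.pairing (conjMul 𝕜) F (∂_{b i} (∂_{b i} F))).integrable
  have e : ∫ x, conjMul 𝕜 (F x) (Δ F x) = ((-∑ i, ∫ x, ‖(∂_{b i} F) x‖ ^ 2 : ℝ) : 𝕜) := by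
    simp only [SchwartzMap.laplacian_eq_sum b, sum_apply, map_sum]
    rw [integral_finsetSum _ fun i _ => hi i, RCLike.ofReal_neg, RCLike.ofReal_sum,
      ← Finset.sum_neg_distrib]
    refine Finset.sum_congr rfl fun i _ => ?_
    rw [SchwartzMap.integral_bilinear_lineDerivOp_right_eq_neg_left, ← integral_ofReal]
    congr 1
    refine integral_congr_ae (Eventually.of_forall fun x => ?_)
    simp only [conjMul_apply, RCLike.conj_mul, RCLike.ofReal_pow]
  rw [inner_graph_eq hf hf hp1 hp2, ← hF, e, RCLike.smul_re, RCLike.ofReal_re]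
  have : 0 ≤ ∑ i, ∫ x, ‖(∂_{b i} F) x‖ ^ 2 :=
    Finset.sum_nonneg fun i _ => integral_nonneg fun x => by positivity
  linarith

theorem minimalOperator_dense : Dense ((minimalOperator 𝕜).domain : Set (L2 𝕜)) := by
  rw [Submodule.dense_iff_topologicalClosure_eq_top, Submodule.topologicalClosure_eq_top_iff,
    Submodule.eq_bot_iff]
  intro v hv
  rw [Submodule.mem_orthogonal] at hv
  have h := IsOpen.ae_eq_zero_of_integral_contDiff_smul_eq_zero (μ := volume)
    (isOpen_compl_singleton (x := (0 : R3))) (f := v)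
    (((Lp.memLp v).locallyIntegrable (by norm_num)).locallyIntegrableOn _) fun g hg hgc hgs => by
      have hgt : IsPuncturedTest (𝕜 := ℝ) g := ⟨hg, hgc, fun h0 => hgs h0 rfl⟩
      obtain ⟨p, hp, hp1, -⟩ := (hgt.ofReal (𝕜 := 𝕜)).exists_mem_graph
      rw [← hv p.1 (LinearPMap.mem_domain_of_mem_graph hp), inner_eq_integral hp1 EventuallyEq.rfl]
      refine integral_congr_ae (Eventually.of_forall fun x => ?_)
      simp only [RCLike.conj_ofReal, RCLike.real_smul_eq_coe_mul]
  have hne : ∀ᵐ x : R3 ∂volume, x ≠ 0 := by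
    rw [ae_iff]; simp
  refine Lp.ext ?_
  filter_upwards [h, hne, Lp.coeFn_zero 𝕜 2 (volume : Measure R3)] with x h1 h2 h3
  rw [h3, h1 h2]
  rfl

theorem psiL2_eigen {γ : ℝ} (hγ : 0 < γ) : ∀ p ∈ (minimalOperator 𝕜).graph,
    ⟪psiL2 𝕜 hγ, p.2⟫_𝕜 = ((γ ^ 2 / 2 : ℝ) : 𝕜) * ⟪psiL2 𝕜 hγ, p.1⟫_𝕜 := by
  rw [graph_minimalOperator]
  rintro p ⟨f, hf, hp1, hp2⟩
  have hψ : psiL2 𝕜 hγ =ᵐ[volume] fun x => ((psi γ x : ℝ) : 𝕜) := (memLp_psi 𝕜 hγ).coeFn_toLp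
  have h0 : ⟪psiL2 𝕜 hγ, ((γ ^ 2 / 2 : ℝ) : 𝕜) • p.1 - p.2⟫_𝕜 = 0 := by
    have hd : (((γ ^ 2 / 2 : ℝ) : 𝕜) • p.1 - p.2 : L2 𝕜) =ᵐ[volume]
        fun x => (γ ^ 2 / 2 : ℝ) • f x - halfLaplacian f x := by
      filter_upwards [Lp.coeFn_sub (((γ ^ 2 / 2 : ℝ) : 𝕜) • p.1) p.2,
        Lp.coeFn_smul ((γ ^ 2 / 2 : ℝ) : 𝕜) p.1, hp1, hp2] with x h1 h2 h3 h4
      rw [h1, Pi.sub_apply, h2, Pi.smul_apply, h3, h4, smul_eq_mul, RCLike.real_smul_eq_coe_mul]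
    rw [inner_eq_integral hψ hd, ← integral_psi_smul_eq_zero γ hf]
    refine integral_congr_ae (Eventually.of_forall fun x => ?_)
    simp only [RCLike.conj_ofReal, RCLike.real_smul_eq_coe_mul]
  rw [inner_sub_right, inner_smul_right, sub_eq_zero] at h0
  exact h0.symm

/-- Against real test functions the condition splits into the real and imaginary parts of `v`; each
is a real multiple of `ψ_γ` by `exists_ae_eq_mul_psi`. -/
theorem psiL2_simple {γ : ℝ} (hγ : 0 < γ) (v : L2 𝕜)
    (hv : ∀ p ∈ (minimalOperator 𝕜).graph,
      ⟪v, p.2⟫_𝕜 = ((γ ^ 2 / 2 : ℝ) : 𝕜) * ⟪v, p.1⟫_𝕜) :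
    v ∈ Submodule.span 𝕜 {psiL2 𝕜 hγ} := by
  have hint : ∀ f : 𝓢(R3, ℝ), Integrable (fun x => v x * (f x : 𝕜)) volume := fun f =>
    (Lp.memLp v).integrable_mul (f.memLp 2 volume).ofReal
  have key : ∀ f : 𝓢(R3, ℝ), IsPuncturedTest (𝕜 := ℝ) f →
      ∫ x, v x * ((helmholtz (γ ^ 2 / 2) f x : ℝ) : 𝕜) = 0 := by
    intro f hf
    obtain ⟨p, hp, hp1, hp2⟩ := (hf.ofReal (𝕜 := 𝕜)).exists_mem_graph
    have h0 : ⟪v, ((γ ^ 2 / 2 : ℝ) : 𝕜) • p.1 - p.2⟫_𝕜 = 0 := by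
      rw [inner_sub_right, inner_smul_right, hv p hp, sub_self]
    have hd : (((γ ^ 2 / 2 : ℝ) : 𝕜) • p.1 - p.2 : L2 𝕜) =ᵐ[volume]
        fun x => ((helmholtz (γ ^ 2 / 2) f x : ℝ) : 𝕜) := by
      filter_upwards [Lp.coeFn_sub (((γ ^ 2 / 2 : ℝ) : 𝕜) • p.1) p.2,
        Lp.coeFn_smul ((γ ^ 2 / 2 : ℝ) : 𝕜) p.1, hp1, hp2] with x h1 h2 h3 h4
      rw [h1, Pi.sub_apply, h2, Pi.smul_apply, h3, h4, hf.halfLaplacian_ofReal, helmholtz_apply,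
        halfLaplacian, SchwartzMap.laplacian_apply]
      simp only [smul_eq_mul, RCLike.ofReal_sub, RCLike.ofReal_mul]
    rw [inner_eq_integral EventuallyEq.rfl hd] at h0
    have h1 := congrArg conj h0
    rw [← integral_conj, map_zero] at h1
    rw [← h1]
    refine integral_congr_ae (Eventually.of_forall fun x => ?_)
    simp only [map_mul, RCLike.conj_conj, RCLike.conj_ofReal]
  obtain ⟨a, ha⟩ := exists_ae_eq_mul_psi hγ (Lp.memLp v).re fun f hf => by
    have h := congrArg RCLike.re (key f hf)
    rw [← integral_re (hint _), map_zero] at h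
    simpa only [RCLike.re_mul_ofReal] using h
  obtain ⟨b, hb⟩ := exists_ae_eq_mul_psi hγ (Lp.memLp v).im fun f hf => by
    have h := congrArg RCLike.im (key f hf)
    rw [← integral_im (hint _), map_zero] at h
    simpa only [RCLike.im_mul_ofReal] using h
  refine Submodule.mem_span_singleton.2 ⟨(a : 𝕜) + (b : 𝕜) * RCLike.I, Lp.ext ?_⟩
  filter_upwards [ha, hb, (memLp_psi 𝕜 hγ).coeFn_toLp,
    Lp.coeFn_smul ((a : 𝕜) + (b : 𝕜) * RCLike.I) (psiL2 𝕜 hγ)] with x h1 h2 h3 h4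
  rw [h4, Pi.smul_apply, psiL2, h3, ← RCLike.re_add_im (v x)]
  rw [h1, h2]
  simp only [smul_eq_mul, RCLike.ofReal_mul]
  ring

theorem hasSimpleDeficiency_minimalOperator (𝕜 : Type*) [RCLike 𝕜] {γ : ℝ} (hγ : 0 < γ) :
    HasSimpleDeficiency (minimalOperator 𝕜) (γ ^ 2 / 2) (psiL2 𝕜 hγ) where
  dense := minimalOperator_dense
  symm := minimalOperator_symm
  nonpos := minimalOperator_nonpos
  pos := by positivity
  eigen := psiL2_eigen hγ
  simple := psiL2_simple hγ

theorem isZeroRangeExtension_iff {γ : ℝ} (hγ : 0 < γ) (A : L2 𝕜 →ₗ.[𝕜] L2 𝕜) :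
    IsZeroRangeExtension hγ A ↔ A = zeroRangeOperator 𝕜 hγ := by
  have h := hasSimpleDeficiency_minimalOperator 𝕜 hγ
  constructor
  · exact fun hA => h.selfAdjoint_eq_extension hA.selfAdjoint hA.extends_minimal hA.eigen
  · rintro rfl
    exact ⟨h.extension_isSelfAdjoint, LinearPMap.le_of_le_graph h.graph_le_extension,
      h.eigen_mem_extension⟩

theorem zeroRangeOperator_re_inner_le {γ : ℝ} (hγ : 0 < γ) :
    ∀ p ∈ (zeroRangeOperator 𝕜 hγ).graph, RCLike.re ⟪p.2, p.1⟫_𝕜 ≤ γ ^ 2 / 2 * ‖p.1‖ ^ 2 :=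
  fun _ hp => (hasSimpleDeficiency_minimalOperator 𝕜 hγ).extension_re_inner_le hp

theorem zeroRangeOperator_dense {γ : ℝ} (hγ : 0 < γ) :
    Dense ((zeroRangeOperator 𝕜 hγ).domain : Set (L2 𝕜)) :=
  minimalOperator_dense.mono
    (LinearPMap.le_of_le_graph (hasSimpleDeficiency_minimalOperator 𝕜 hγ).graph_le_extension).1

/-- The order on `𝕜` also demands a vanishing imaginary part, which comes from symmetry; the real
part is the form bound. -/
theorem zeroRangeOperator_lower_bound {γ : ℝ} (hγ : 0 < γ) (u : (zeroRangeOperator 𝕜 hγ).domain) :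
    0 ≤ ⟪-(zeroRangeOperator 𝕜 hγ u), (u : L2 𝕜)⟫_𝕜
      + ((γ ^ 2 / 2 : ℝ) : 𝕜) * ⟪(u : L2 𝕜), (u : L2 𝕜)⟫_𝕜 := by
  have hu := (zeroRangeOperator 𝕜 hγ).mem_graph u
  have h1 := zeroRangeOperator_re_inner_le hγ _ hu
  have h2 := (hasSimpleDeficiency_minimalOperator 𝕜 hγ).extension_symm hu hu
  dsimp only at h1 h2
  have h3 := RCLike.conj_eq_iff_im.1 ((inner_conj_symm _ _).trans h2.symm)
  rw [RCLike.nonneg_iff, inner_neg_left, inner_self_eq_norm_sq_to_K, ← RCLike.ofReal_pow,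
    ← RCLike.ofReal_mul]
  simp only [map_add, map_neg, RCLike.ofReal_re, RCLike.ofReal_im]
  constructor
  · linarith
  · rw [h3, neg_zero, add_zero]

end Minimal

end ZeroRange

theorem corollary1 {𝕜 : Type*} [RCLike 𝕜] (γ : ℝ) (hγ : 0 < γ) :
    -- `𝓛_γ` is the unique self-adjoint extension of `½ Δ` on `C_c^∞(ℝ³ ∖ {0})` having `ψ_γ` as an
    -- eigenfunction with eigenvalue `γ² / 2`
    (∀ A : ZeroRange.L2 𝕜 →ₗ.[𝕜] ZeroRange.L2 𝕜,
      ZeroRange.IsZeroRangeExtension hγ A ↔ A = ZeroRange.zeroRangeOperator 𝕜 hγ) ∧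
    -- `-𝓛_γ` is lower bounded with parameter `γ² / 2`
    (∀ u : (ZeroRange.zeroRangeOperator 𝕜 hγ).domain,
      0 ≤ ⟪-(ZeroRange.zeroRangeOperator 𝕜 hγ u), (u : ZeroRange.L2 𝕜)⟫_𝕜
        + ((γ ^ 2 / 2 : ℝ) : 𝕜) * ⟪(u : ZeroRange.L2 𝕜), (u : ZeroRange.L2 𝕜)⟫_𝕜) ∧
    -- `𝓛_γ` generates a unique semigroup `(Q_t)`, and `‖Q_t‖ ≤ exp (γ² t / 2)`
    (∃! Q : ℝ≥0 → ZeroRange.L2 𝕜 →L[𝕜] ZeroRange.L2 𝕜,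
      ZeroRange.IsSemigroupGeneratedBy (ZeroRange.zeroRangeOperator 𝕜 hγ) Q) ∧
    (∀ Q : ℝ≥0 → ZeroRange.L2 𝕜 →L[𝕜] ZeroRange.L2 𝕜,
      ZeroRange.IsSemigroupGeneratedBy (ZeroRange.zeroRangeOperator 𝕜 hγ) Q →
        ∀ t : ℝ≥0, ‖Q t‖ ≤ Real.exp (γ ^ 2 * (t : ℝ) / 2)) := by
  have hc := ZeroRange.zeroRangeOperator_re_inner_le (𝕜 := 𝕜) hγ
  have hd := ZeroRange.zeroRangeOperator_dense (𝕜 := 𝕜) hγ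
  refine ⟨ZeroRange.isZeroRangeExtension_iff hγ, ZeroRange.zeroRangeOperator_lower_bound hγ, ?_,
    fun Q hQ t => (hQ.norm_le hd hc t).trans_eq (by ring_nf)⟩
  obtain ⟨Q, hQ⟩ := ZeroRange.exists_isSemigroupGeneratedBy
    ((ZeroRange.isZeroRangeExtension_iff hγ _).2 rfl).selfAdjoint hc
  exact ⟨Q, hQ, fun Q' hQ' => hQ'.unique hQ hd hc⟩
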